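/- Let $X=(X_n:n\ge 0)$ be an irreducible positive recurrent Markov chain on a finite or countably infinite state space $S$, with transition matrix $P$ and stationary distribution $\pi$. Write $P_x$, $E_x$ for the law of the chain started at $x$ and its expectation, $P_\pi$ for the law of the chain with initial distribution $\pi$, $\tau(z)=\inf\{n\ge 1:X_n=z\}$, $\mathcal F_n=\sigma(X_j:j\le n)$ and $L^1(\pi)=\{h:\sum_x\pi(x)|h(x)|<\infty\}$; for $h\in L^1(\pi)$ put $\pi h=\sum_x\pi(x)h(x)$. Let $f:S\to\mathbb R$ be in $L^1(\pi)$, let $f_c=f-\pi f$, let $S_n(f)=\sum_{j=0}^{n-1}f(X_j)$, and for $x,y\in S$ let $$g_y(x)=E_x\sum_{j=0}^{\tau(y)-1}f_c(X_j).$$ Suppose that $z\in S$ satisfies $$E_z\sum_{j=0}^{\tau(z)-1}j\,|f_c(X_j)|<\infty .$$ Then the expectations defining $g_y(x)$ exist and are finite for all $x,y\in S$, $g_y\in L^1(\pi)$ for every $y\in S$, and for every $y\in S$ the process $$g_y(X_n)+\sum_{j=0}^{n-1}f_c(X_j),\qquad n\ge 0,$$ is a $P_\pi$-martingale adapted to $(\mathcal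 F_n:n\ge 0)$. If, furthermore, $X$ is aperiodic, then for every $x\in S$, as $n\to\infty$, $$E_x\,g_z(X_n)\longrightarrow \pi g_z=\frac{E_z\sum_{j=0}^{\tau(z)-1}(j+1)f_c(X_j)}{E_z\tau(z)}$$ and $$E_x S_n(f)=n\,\pi f+g_z(x)-\pi g_z+o(1),$$ all the expectations involved being finite. -/

import Mathlib

open MeasureTheory ProbabilityTheory Filter Topology
open scoped ENNReal

noncomputable section

namespace PoissonChain

variable {S : Type*} [MeasurableSpace S] [DiscreteMeasurableSpace S]

/-- The one-step transition kernel of the transition matrix `P`, whose row `x` is the probability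
mass function `P x`, so that `P(x, y) = P x y`. -/
def stepKernel (P : S → PMF S) : Kernel S S :=
  ⟨fun x => (P x).toMeasure, Measurable.of_discrete⟩

instance (P : S → PMF S) : IsMarkovKernel (stepKernel P) :=
  ⟨fun x => PMF.toMeasure.isProbabilityMeasure (P x)⟩

/-- The conditional law of `X_{n+1}` given `(X_0, …, X_n)`: it is `P(X_n, ·)`. -/
def historyKernel (P : S → PMF S) (n : ℕ) : Kernel (Finset.Iic n → S) S :=
  (stepKernel P).comap (fun h => h ⟨n, Finset.mem_Iic.2 le_rfl⟩) (measurable_pi_apply _)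

instance (P : S → PMF S) (n : ℕ) : IsMarkovKernel (historyKernel P n) := by
  unfold historyKernel; infer_instance

/-- `P_μ`: the law, on the path space `ℕ → S`, of the Markov chain with transition matrix `P` and
initial distribution `μ`. The chain is the coordinate process `X_n ω = ω n`. -/
def pathLaw (P : S → PMF S) (μ : PMF S) : Measure (ℕ → S) :=
  Kernel.trajMeasure (X := fun _ => S) μ.toMeasure (historyKernel P)

/-- `P_x`: the law of the chain started at `x`. -/
def lawFrom (P : S → PMF S) (x : S) : Measure (ℕ → S) := pathLaw P (PMF.pure x)

/-- `τ(z) = inf {n ≥ 1 : X_n = z}`, equal to `∞` if `z` is never visited after time `0`. -/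
def returnTime (z : S) (ω : ℕ → S) : ℕ∞ :=
  hittingAfter (fun (n : ℕ) (ω : ℕ → S) => ω n) {z} 1 ω

/-- `E_x τ(z)`, as an extended nonnegative number. -/
def meanReturnTime (P : S → PMF S) (x z : S) : ℝ≥0∞ :=
  ∫⁻ ω, (returnTime z ω : ℝ≥0∞) ∂(lawFrom P x)

/-- Every state can be reached from every state. -/
def IsIrreducible (P : S → PMF S) : Prop :=
  ∀ x y, ∃ n : ℕ, 0 < lawFrom P x {ω | ω n = y}

/-- Every state has a finite mean return time. -/
def IsPositiveRecurrent (P : S → PMF S) : Prop :=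
  ∀ x, meanReturnTime P x x < ∞

/-- For every state `x`, the greatest common divisor of `{n ≥ 1 : P_x(X_n = x) > 0}` is `1`. -/
def IsAperiodic (P : S → PMF S) : Prop :=
  ∀ x, ∀ d : ℕ, (∀ n : ℕ, 1 ≤ n → 0 < lawFrom P x {ω | ω n = x} → d ∣ n) → d = 1

/-- `π P = π`. -/
def IsStationary (P : S → PMF S) (π : PMF S) : Prop := π.bind P = π

/-- `h ∈ L¹(π)`, that is `∑ₓ π(x) |h(x)| < ∞`. -/
def MemL1 (π : PMF S) (h : S → ℝ) : Prop := Summable fun x => (π x).toReal * |h x|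

/-- `π h = ∑ₓ π(x) h(x)`. -/
def mean (π : PMF S) (h : S → ℝ) : ℝ := ∑' x, (π x).toReal * h x

/-- `f_c = f - π f`. -/
def centered (π : PMF S) (f : S → ℝ) (x : S) : ℝ := f x - mean π f

/-- `∑_{j=0}^{τ(z)-1} h_j(X_j)`. Under the standing assumptions `τ(z)` is almost surely finite;
on the null event `τ(z) = ∞` the value is set to `0`. -/
def cycleSum (z : S) (h : ℕ → S → ℝ) (ω : ℕ → S) : ℝ :=
  ∑ j ∈ Finset.range (returnTime z ω).toNat, h j (ω j)

/-- `E_x ∑_{j=0}^{τ(z)-1} h_j(X_j)` for the nonnegative functions `h_j`, as an extended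
nonnegative number. -/
def lcycleMean (P : S → PMF S) (x z : S) (h : ℕ → S → ℝ≥0∞) : ℝ≥0∞ :=
  ∫⁻ ω, ∑' j : ℕ, (if (j : ℕ∞) < returnTime z ω then h j (ω j) else 0) ∂(lawFrom P x)

/-- `g_z(x) = E_x ∑_{j=0}^{τ(z)-1} f_c(X_j)`. -/
def poissonSol (P : S → PMF S) (π : PMF S) (f : S → ℝ) (z x : S) : ℝ :=
  ∫ ω, cycleSum z (fun _ => centered π f) ω ∂(lawFrom P x)

/-- `S_n(h) = ∑_{j=0}^{n-1} h(X_j)`. -/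
def partialSum (h : S → ℝ) (n : ℕ) (ω : ℕ → S) : ℝ := ∑ j ∈ Finset.range n, h (ω j)

/-- The process `g_z(X_n) + ∑_{j=0}^{n-1} f_c(X_j)`. -/
def poissonMartingale (P : S → PMF S) (π : PMF S) (f : S → ℝ) (z : S) (n : ℕ) (ω : ℕ → S) : ℝ :=
  poissonSol P π f z (ω n) + partialSum (centered π f) n ω

/-- `ℱ_n = σ(X_j : j ≤ n)`. -/
def history : Filtration ℕ (MeasurableSpace.pi : MeasurableSpace (ℕ → S)) :=
  Filtration.piLE (X := fun _ => S)

end PoissonChain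

end

/-! Let `T` be the transition matrix `K` with the column of `y` deleted. Then `Tʲu(x) = E_x[u(X_j);
j < τ(y)]`, so expected cycle sums are potentials `G_y u = ∑ⱼ Tʲu`. Finiteness and limits are
treated for `[0,∞]`-valued matrices; `f_c` is split into positive and negative parts, which are
subtracted only once they are known to be finite.

The cycle formula `pair_eq_potential`, `πu = π(y) G_y u(y)`, applied to `u = G_z|f_c|` together with
`potential_potential`, turns the moment hypothesis into `π G_z|f_c| < ∞`. The same computation for
the two parts of `f_c` gives the formula for `πg_z`. `pair_potential_ne_top` passes from `z` to
every `y`.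

The potential satisfies `K G_y u + u = G_y u + K(·,y) G_y u(y)`. As `πf_c = 0`, the cycle formula
makes the last term the same for both parts of `f_c`; it cancels, leaving the Poisson equation `K
g_y + f_c = g_y`, hence the martingale.

In the aperiodic case `tendsto_iterate_op` gives `Kⁿh → πh` for `π`-integrable `h`. It rests on two
independent copies of the chain: the limsup of the differences of transition probabilities is
subharmonic, hence harmonic, and vanishes on the diagonal, hence everywhere. Constancy of the
martingale's expectation under `P_x` then yields the expansion of `E_x S_n(f)`. -/

noncomputable section

namespace PoissonChain

/-! ### Nonnegative matrices and their potentials. -/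

section Matrix

variable {α : Type*}

/-- The action `h ↦ K h` of a nonnegative matrix on nonnegative functions. -/
def op (K : α → α → ℝ≥0∞) (h : α → ℝ≥0∞) (x : α) : ℝ≥0∞ := ∑' w, K x w * h w

/-- The pairing `p h` of a nonnegative weight and a nonnegative function. -/
def pair (p h : α → ℝ≥0∞) : ℝ≥0∞ := ∑' x, p x * h x

/-- The indicator function of a state. -/
def unit (w : α) : α → ℝ≥0∞ := Set.indicator {w} 1

open Classical in
/-- The matrix `K` with the column of `y` set to zero. -/
def taboo (K : α → α → ℝ≥0∞) (y : α) : α → α → ℝ≥0∞ := fun x w => if w = y then 0 else K x w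

/-- The potential `∑ⱼ Kʲ h`. -/
def potential (K : α → α → ℝ≥0∞) (h : α → ℝ≥0∞) (x : α) : ℝ≥0∞ := ∑' j : ℕ, (op K)^[j] h x

variable {K : α → α → ℝ≥0∞} {h h' : α → ℝ≥0∞} {p : α → ℝ≥0∞}

lemma op_eq_pair (x : α) : op K h x = pair (K x) h := rfl

lemma pair_mono (hh : h ≤ h') : pair p h ≤ pair p h' :=
  ENNReal.tsum_le_tsum fun w => mul_le_mul_right (hh w) _

lemma pair_add : pair p (h + h') = pair p h + pair p h' := by
  simp [pair, mul_add, ENNReal.tsum_add]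

lemma pair_smul (c : ℝ≥0∞) : pair p (c • h) = c * pair p h := by
  simp [pair, ← ENNReal.tsum_mul_left, mul_left_comm]

lemma pair_tsum {ι : Type*} (u : ι → α → ℝ≥0∞) :
    pair p (fun x => ∑' i, u i x) = ∑' i, pair p (u i) := by
  simp only [pair, ← ENNReal.tsum_mul_left]
  exact ENNReal.tsum_comm

@[simp] lemma unit_self (w : α) : unit w w = 1 := by simp [unit]

lemma unit_of_ne {w x : α} (hx : x ≠ w) : unit w x = 0 := by simp [unit, hx]

lemma unit_le_one (w x : α) : unit w x ≤ 1 := by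
  by_cases hx : x = w
  · simp [hx]
  · simp [unit_of_ne hx]

lemma pair_unit (w : α) : pair p (unit w) = p w := by
  rw [pair, tsum_eq_single w fun x hx => by simp [unit_of_ne hx]]
  simp

lemma mul_le_pair (x : α) : p x * h x ≤ pair p h := ENNReal.le_tsum (f := fun x => p x * h x) x

lemma op_mono (hh : h ≤ h') : op K h ≤ op K h' := fun _ => pair_mono hh

lemma op_add : op K (h + h') = op K h + op K h' := funext fun _ => pair_add

lemma op_smul (c : ℝ≥0∞) : op K (c • h) = c • op K h := funext fun _ => pair_smul c

lemma op_tsum {ι : Type*} (u : ι → α → ℝ≥0∞) :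
    op K (fun x => ∑' i, u i x) = fun x => ∑' i, op K (u i) x := funext fun _ => pair_tsum u

lemma iterate_op_mono (n : ℕ) (hh : h ≤ h') : (op K)^[n] h ≤ (op K)^[n] h' := by
  induction n generalizing h h' with
  | zero => exact hh
  | succ n ih => exact ih (op_mono hh)

lemma iterate_op_add (n : ℕ) : (op K)^[n] (h + h') = (op K)^[n] h + (op K)^[n] h' := by
  induction n generalizing h h' with
  | zero => rfl
  | succ n ih => simp only [Function.iterate_succ_apply, op_add, ih]

lemma iterate_op_smul (n : ℕ) (c : ℝ≥0∞) : (op K)^[n] (c • h) = c • (op K)^[n] h := by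
  induction n generalizing h with
  | zero => rfl
  | succ n ih => simp only [Function.iterate_succ_apply, op_smul, ih]

lemma iterate_op_tsum {ι : Type*} (n : ℕ) (u : ι → α → ℝ≥0∞) :
    (op K)^[n] (fun x => ∑' i, u i x) = fun x => ∑' i, (op K)^[n] (u i) x := by
  induction n generalizing u with
  | zero => rfl
  | succ n ih => simp only [Function.iterate_succ_apply, op_tsum, ih]

lemma smul_unit_le (w : α) : h w • unit w ≤ h := by
  intro x
  by_cases hx : x = w
  · simp [hx]
  · simp [unit_of_ne hx]

lemma eq_tsum_smul_unit (h : α → ℝ≥0∞) : h = fun x => ∑' w, (h w • unit w) x := by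
  ext x
  rw [tsum_eq_single x fun w hw => by simp [unit_of_ne hw.symm]]
  simp

lemma mul_iterate_op_unit_le (n : ℕ) (w x : α) : h w * (op K)^[n] (unit w) x ≤ (op K)^[n] h x := by
  have := iterate_op_mono (K := K) n (smul_unit_le (h := h) w) x
  rwa [iterate_op_smul] at this

lemma iterate_op_eq_pair (n : ℕ) (x : α) :
    (op K)^[n] h x = pair (fun w => (op K)^[n] (unit w) x) h := by
  conv_lhs => rw [eq_tsum_smul_unit h, iterate_op_tsum]
  simp [iterate_op_smul, pair, mul_comm]

lemma potential_eq (h : α → ℝ≥0∞) : potential K h = h + op K (potential K h) := by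
  ext x
  have : op K (potential K h) x = ∑' j : ℕ, (op K)^[j + 1] h x := by
    unfold potential
    rw [op_tsum]
    simp only [Function.iterate_succ_apply']
  rw [Pi.add_apply, this, potential, tsum_eq_zero_add' ENNReal.summable]
  rfl

lemma le_potential : h ≤ potential K h := by
  rw [potential_eq]
  exact le_self_add

lemma potential_mono (hh : h ≤ h') : potential K h ≤ potential K h' :=
  fun x => ENNReal.tsum_le_tsum fun n => iterate_op_mono n hh x

/-- Applying `Kⁿ` to the hypothesis splits the remainder `Kⁿv` into `Kⁿh` and the next remainder.
Nothing is subtracted, so `v` may be infinite. -/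
lemma sum_iterate_le_of_supersolution {v : α → ℝ≥0∞} (hv : h + op K v ≤ v) (n : ℕ) (x : α) :
    ∑ j ∈ Finset.range n, (op K)^[j] h x + (op K)^[n] v x ≤ v x := by
  induction n with
  | zero => simp
  | succ n ih =>
    refine le_trans ?_ ih
    have := iterate_op_mono (K := K) n hv x
    rw [iterate_op_add, Pi.add_apply, ← Function.iterate_succ_apply] at this
    rw [Finset.sum_range_succ, add_assoc]
    gcongr

/-- The potential is the smallest solution of `h + K v ≤ v`. -/
lemma potential_le_of_supersolution {v : α → ℝ≥0∞} (hv : h + op K v ≤ v) : potential K h ≤ v := by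
  intro x
  unfold potential
  rw [ENNReal.tsum_eq_iSup_nat]
  exact iSup_le fun n => le_self_add.trans (sum_iterate_le_of_supersolution hv n x)

lemma potential_tsum {ι : Type*} (u : ι → α → ℝ≥0∞) :
    potential K (fun x => ∑' i, u i x) = fun x => ∑' i, potential K (u i) x := by
  ext x
  simp only [potential, iterate_op_tsum]
  exact ENNReal.tsum_comm

lemma potential_smul (c : ℝ≥0∞) : potential K (c • h) = c • potential K h := by
  ext x
  simp [potential, iterate_op_smul, ENNReal.tsum_mul_left]

/-- Expanding gives a sum of `K^(k+j) h` over pairs, and `n = k + j` in `n + 1` ways: the source of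
the weight `j + 1` in the formula for `πg_z`. -/
lemma potential_potential (x : α) :
    potential K (potential K h) x = ∑' n : ℕ, ((n : ℝ≥0∞) + 1) * (op K)^[n] h x := by
  have h1 : potential K (potential K h) x = ∑' q : ℕ × ℕ, (op K)^[q.1 + q.2] h x := by
    rw [ENNReal.tsum_prod (f := fun k j => (op K)^[k + j] h x)]
    conv_lhs => unfold potential
    refine tsum_congr fun k => ?_
    rw [iterate_op_tsum]
    simp only [Function.iterate_add_apply]
  rw [h1, ← Finset.HasAntidiagonal.sigmaAntidiagonalEquivProd.tsum_eq, ENNReal.tsum_sigma']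
  refine tsum_congr fun n => ?_
  rw [tsum_fintype]
  have : ∀ b : Finset.HasAntidiagonal.antidiagonal n, (op K)^[(b : ℕ × ℕ).1 + (b : ℕ × ℕ).2] h x
      = (op K)^[n] h x := fun b => by rw [Finset.HasAntidiagonal.mem_antidiagonal.1 b.2]
  simp [Finset.HasAntidiagonal.sigmaAntidiagonalEquivProd, this]

lemma op_eq_taboo_add (y x : α) : op K h x = op (taboo K y) h x + K x y * h y := by
  classical
  have : ∀ w, K x w * h w = taboo K y x w * h w + (K x y * h y) * unit y w := by
    intro w
    by_cases hw : w = y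
    · simp [hw, taboo]
    · simp [hw, taboo, unit_of_ne hw]
  rw [op, tsum_congr this, ENNReal.tsum_add, ENNReal.tsum_mul_left]
  congr 1
  rw [tsum_eq_single y fun w hw => unit_of_ne hw]
  simp

lemma taboo_op_le (y : α) : op (taboo K y) h ≤ op K h := fun x => by
  rw [op_eq_taboo_add (K := K) (h := h) y]
  exact le_self_add

lemma op_le_const {c : ℝ≥0∞} {x : α} (hK : ∑' w, K x w ≤ 1) (hc : ∀ w, h w ≤ c) : op K h x ≤ c :=
  calc op K h x ≤ ∑' w, K x w * c := ENNReal.tsum_le_tsum fun w => mul_le_mul_right (hc w) _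
    _ = (∑' w, K x w) * c := ENNReal.tsum_mul_right
    _ ≤ 1 * c := by gcongr
    _ = c := one_mul c

lemma taboo_tsum_le (y x : α) : ∑' w, taboo K y x w ≤ ∑' w, K x w :=
  ENNReal.tsum_le_tsum fun w => by unfold taboo; split_ifs <;> simp

lemma iterate_op_le_const {c : ℝ≥0∞} (hK : ∀ x, ∑' w, K x w ≤ 1) (hc : ∀ w, h w ≤ c) (n : ℕ)
    (x : α) : (op K)^[n] h x ≤ c := by
  induction n generalizing x with
  | zero => exact hc x
  | succ n ih => rw [Function.iterate_succ_apply']; exact op_le_const (hK x) ih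

/-- The maximum principle for the number of visits to `z`. -/
lemma potential_unit_le (hK : ∀ x, ∑' w, K x w ≤ 1) (z x : α) :
    potential K (unit z) x ≤ potential K (unit z) z := by
  have key : ∀ (n : ℕ) (x : α), ∑ j ∈ Finset.range n, (op K)^[j] (unit z) x
      ≤ potential K (unit z) z := by
    intro n
    induction n with
    | zero => simp
    | succ n ih =>
      intro x
      by_cases hx : x = z
      · subst hx
        exact ENNReal.sum_le_tsum _
      -- Off `z` time `0` contributes nothing, so the count is an average of the counts over one
      -- step fewer.
      · rw [Finset.sum_range_succ']
        simp only [Function.iterate_zero, id, unit_of_ne hx, add_zero]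
        have : ∑ j ∈ Finset.range n, (op K)^[j + 1] (unit z) x
            = op K (fun x => ∑ j ∈ Finset.range n, (op K)^[j] (unit z) x) x := by
          simp only [Function.iterate_succ_apply', op, Finset.mul_sum]
          rw [Summable.tsum_finsetSum fun _ _ => ENNReal.summable]
        rw [this]
        exact op_le_const (hK x) ih
  rw [potential, ENNReal.tsum_eq_iSup_nat]
  exact iSup_le fun n => key n x

/-- Reverse Fatou for the measure with density `p` with respect to counting measure. -/
lemma limsup_pair_le [Countable α] (u : ℕ → α → ℝ≥0∞) (b : α → ℝ≥0∞) (hu : ∀ n x, u n x ≤ b x)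
    (hb : pair p b ≠ ∞) :
    limsup (fun n => pair p (u n)) atTop ≤ pair p fun x => limsup (fun n => u n x) atTop := by
  let _ : MeasurableSpace α := ⊤
  have e : ∀ v : α → ℝ≥0∞, pair p v = ∫⁻ x, v x ∂(Measure.count.withDensity p) := fun v => by
    rw [lintegral_withDensity_eq_lintegral_mul _ .of_discrete .of_discrete, lintegral_count]
    rfl
  simp only [e] at hb ⊢
  exact limsup_lintegral_le b (fun n => .of_discrete) (fun n => .of_forall (hu n)) hb

lemma tendsto_pair_of_dominated [Countable α] {u : ℕ → α → ℝ≥0∞} {v b : α → ℝ≥0∞}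
    (hu : ∀ n x, u n x ≤ b x) (hb : pair p b ≠ ∞) (hv : ∀ x, Tendsto (u · x) atTop (𝓝 (v x))) :
    Tendsto (fun n => pair p (u n)) atTop (𝓝 (pair p v)) := by
  let _ : MeasurableSpace α := ⊤
  have e : ∀ v : α → ℝ≥0∞, pair p v = ∫⁻ x, v x ∂(Measure.count.withDensity p) := fun v => by
    rw [lintegral_withDensity_eq_lintegral_mul _ .of_discrete .of_discrete, lintegral_count]
    rfl
  simp only [e] at hb ⊢
  exact tendsto_lintegral_of_dominated_convergence b (fun n => .of_discrete)
    (fun n => .of_forall (hu n)) hb (.of_forall hv)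

end Matrix

/-! ### Stationary distributions, the cycle formula and change of the reference state. -/

section Stationary

variable {α : Type*} {K : α → α → ℝ≥0∞} {h : α → ℝ≥0∞} {π : α → ℝ≥0∞}

lemma pair_iterate_op (hst : ∀ h, pair π (op K h) = pair π h) (n : ℕ) (h : α → ℝ≥0∞) :
    pair π ((op K)^[n] h) = pair π h := by
  induction n generalizing h with
  | zero => rfl
  | succ n ih => rw [Function.iterate_succ_apply, ih, hst]

lemma stationary_ne_zero (hπ : ∑' x, π x = 1) (hst : ∀ h, pair π (op K h) = pair π h)
    (hirr : ∀ x w, ∃ n, (op K)^[n] (unit w) x ≠ 0) (w : α) : π w ≠ 0 := by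
  intro hw
  obtain ⟨x, hx⟩ : ∃ x, π x ≠ 0 := by
    by_contra! hx
    simp [hx] at hπ
  obtain ⟨n, hn⟩ := hirr x w
  have h1 := mul_le_pair (p := π) (h := (op K)^[n] (unit w)) x
  rw [pair_iterate_op hst, pair_unit, hw, nonpos_iff_eq_zero] at h1
  exact mul_ne_zero hx hn h1

lemma ne_top_of_pair_ne_top (hπ : ∀ x, π x ≠ 0) (hh : pair π h ≠ ∞) (x : α) : h x ≠ ∞ := by
  intro hx
  have h1 := mul_le_pair (p := π) (h := h) x
  rw [hx, ENNReal.mul_top (hπ x), top_le_iff] at h1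
  exact hh h1

/-- From `V = 1 + TV` one gets `KV ≤ V + V(y)`, so `KⁿV(y) ≤ (n+1)V(y) < ∞`. An infinite `V(x)`
would make `KⁿV(y)` infinite for some `n` with `Kⁿ(y,x) > 0`. -/
lemma potential_taboo_one_ne_top (hK : ∀ x, ∑' w, K x w = 1)
    (hirr : ∀ x w, ∃ n, (op K)^[n] (unit w) x ≠ 0) {y : α}
    (hy : potential (taboo K y) 1 y ≠ ∞) (x : α) : potential (taboo K y) 1 x ≠ ∞ := by
  set V := potential (taboo K y) 1 with hV
  have hone : ∀ n : ℕ, op K (fun _ => (n : ℝ≥0∞) * V y) ≤ fun _ => (n : ℝ≥0∞) * V y :=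
    fun n x => op_le_const (hK x).le fun _ => le_rfl
  have hstep : op K V ≤ V + fun _ => V y := by
    intro x
    rw [op_eq_taboo_add y, Pi.add_apply]
    refine add_le_add ?_ ?_
    · exact le_add_self.trans (congrFun (potential_eq (K := taboo K y) 1) x).ge
    · calc K x y * V y ≤ 1 * V y := by
            gcongr
            exact (hK x) ▸ ENNReal.le_tsum y
        _ = V y := one_mul _
  have hn : ∀ n : ℕ, (op K)^[n] V ≤ V + fun _ => (n : ℝ≥0∞) * V y := by
    intro n
    induction n with
    | zero => intro x; simp
    | succ n ih =>
      intro x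
      rw [Function.iterate_succ_apply']
      refine (op_mono ih x).trans ?_
      rw [op_add, Pi.add_apply]
      refine (add_le_add (hstep x) (hone n x)).trans ?_
      simp only [Pi.add_apply, Nat.cast_add, Nat.cast_one, add_mul, one_mul]
      rw [add_assoc, add_comm (V y)]
  obtain ⟨n, hne⟩ := hirr y x
  intro hx
  have h1 := (mul_iterate_op_unit_le (K := K) (h := V) n x y).trans (hn n y)
  rw [hx, ENNReal.top_mul hne, top_le_iff] at h1
  simp [ENNReal.add_eq_top, ENNReal.mul_eq_top, hy] at h1

/-- Stationarity is applied to `h` with its value at `y` replaced by zero, on which `K` acts as the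
taboo matrix acts on `h`. -/
lemma pair_eq_taboo_add (hst : ∀ h, pair π (op K h) = pair π h) (y : α) (h : α → ℝ≥0∞) :
    pair π h = π y * h y + pair π (op (taboo K y) h) := by
  classical
  have e : h = h y • unit y + fun x => if x = y then 0 else h x := by
    ext x
    by_cases hx : x = y
    · simp [hx]
    · simp [hx, unit_of_ne hx]
  conv_lhs => rw [e]
  rw [pair_add, pair_smul, pair_unit, mul_comm, ← hst]
  congr 2
  ext x
  refine tsum_congr fun w => ?_
  by_cases hw : w = y <;> simp [taboo, hw]

lemma pair_eq_sum_add (hst : ∀ h, pair π (op K h) = pair π h) (y : α) (h : α → ℝ≥0∞) (n : ℕ) :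
    pair π h = π y * ∑ j ∈ Finset.range n, (op (taboo K y))^[j] h y
      + pair π ((op (taboo K y))^[n] h) := by
  induction n with
  | zero => simp
  | succ n ih =>
    rw [ih, Finset.sum_range_succ, mul_add, add_assoc, Function.iterate_succ_apply',
      ← pair_eq_taboo_add hst]

/-- The cycle formula for the stationary distribution. -/
lemma pair_eq_potential [Countable α] (hK : ∀ x, ∑' w, K x w = 1) (hπ : ∑' x, π x = 1)
    (hst : ∀ h, pair π (op K h) = pair π h)
    (hirr : ∀ x w, ∃ n, (op K)^[n] (unit w) x ≠ 0) {y : α}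
    (hy : potential (taboo K y) 1 y ≠ ∞) (h : α → ℝ≥0∞) :
    pair π h = π y * potential (taboo K y) h y := by
  have hT : ∀ x, ∑' w, taboo K y x w ≤ 1 := fun x => (taboo_tsum_le y x).trans (hK x).le
  have htop : π y ≠ ∞ := ne_top_of_le_ne_top ENNReal.one_ne_top (hπ ▸ ENNReal.le_tsum y)
  -- For indicators the remainder `πTⁿh` vanishes: it is dominated by `1`, and `Tⁿ1` is the general
  -- term of a convergent series. General `h` follows by countable additivity.
  have key : ∀ w, pair π (unit w) = π y * potential (taboo K y) (unit w) y := by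
    intro w
    have h0 : Tendsto (fun n => pair π ((op (taboo K y))^[n] (unit w))) atTop (𝓝 0) := by
      have : pair π (0 : α → ℝ≥0∞) = 0 := by simp [pair]
      rw [← this]
      refine tendsto_pair_of_dominated (b := 1) (fun n => iterate_op_le_const hT (unit_le_one w) n)
        (by simp [pair, hπ]) fun x => ?_
      have hs := potential_taboo_one_ne_top hK hirr hy x
      refine tendsto_of_tendsto_of_tendsto_of_le_of_le tendsto_const_nhds
        (ENNReal.tendsto_atTop_zero_of_tsum_ne_top hs) (fun n => zero_le)
        fun n => iterate_op_mono n (unit_le_one w) x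
    have h1 := (ENNReal.Tendsto.const_mul (a := π y)
      (ENNReal.tendsto_nat_tsum fun j => (op (taboo K y))^[j] (unit w) y) (Or.inr htop)).add h0
    rw [add_zero] at h1
    refine tendsto_nhds_unique (tendsto_const_nhds.congr fun n => ?_) h1
    exact pair_eq_sum_add hst y (unit w) n
  rw [eq_tsum_smul_unit h, pair_tsum, potential_tsum, ← ENNReal.tsum_mul_left]
  refine tsum_congr fun w => ?_
  rw [pair_smul, potential_smul, key, Pi.smul_apply, smul_eq_mul]
  ring

/-- If `π G_z` is finite for the cycle potential `G_z` of `h` at `z`, then so is `π G_y`. -/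
lemma pair_potential_ne_top [Countable α] (hK : ∀ x, ∑' w, K x w = 1) (hπ : ∑' x, π x = 1)
    (hst : ∀ h, pair π (op K h) = pair π h)
    (hirr : ∀ x w, ∃ n, (op K)^[n] (unit w) x ≠ 0)
    (hrec : ∀ y, potential (taboo K y) 1 y ≠ ∞) {z : α}
    (hz : pair π (potential (taboo K z) h) ≠ ∞) (y : α) :
    pair π (potential (taboo K y) h) ≠ ∞ := by
  by_cases hyz : z = y
  · exact hyz ▸ hz
  have hpos := stationary_ne_zero hπ hst hirr
  have htop : ∀ x, π x ≠ ∞ := fun x =>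
    ne_top_of_le_ne_top ENNReal.one_ne_top (hπ ▸ ENNReal.le_tsum x)
  set T := taboo K y with hT
  set G := potential (taboo K z) h with hG
  set H := potential T (unit z) with hH
  have hTone : ∀ x, ∑' w, T x w ≤ 1 := fun x => (taboo_tsum_le y x).trans (hK x).le
  have hHy : π z = π y * H y := by
    rw [← pair_unit (p := π) z, pair_eq_potential hK hπ hst hirr (hrec y)]
  have hHy_top : H y ≠ ∞ := fun e => htop z <| by rw [hHy, e, ENNReal.mul_top (hpos y)]
  -- `H(y) = π(z)/π(y)` is nonzero, so some power of `T` leads from `y` to `z`; an infinite `H(z)`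
  -- would then make `H(y)` infinite.
  have hHz : H z ≠ ∞ := by
    obtain ⟨n, hn⟩ : ∃ n, (op T)^[n] (unit z) y ≠ 0 := by
      by_contra! h0
      have : H y = 0 := by simp [hH, potential, h0]
      exact hpos z (by rw [hHy, this, mul_zero])
    intro e
    have h1 := mul_iterate_op_unit_le (K := T) (h := H) n z y
    have h2 : (op T)^[n] H y ≤ H y := by
      refine le_trans ?_ (sum_iterate_le_of_supersolution (K := T) (h := unit z) (v := H) ?_ n y)
      · exact le_add_self
      · exact (potential_eq (K := T) (unit z)).ge
    have h3 := h1.trans h2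
    rw [e, ENNReal.top_mul hn, top_le_iff] at h3
    exact hHy_top h3
  have hGz : G z ≠ ∞ := ne_top_of_pair_ne_top hpos hz z
  -- Heuristically, the sum up to `τ(y)` is at most the sum up to `τ(z)` plus `G(z)` for every visit
  -- to `z` before `τ(y)`. `op T H` counts these visits from time `1` on. Minimality of the
  -- potential replaces the strong Markov property.
  have hsuper : h + op T (G + G z • op T H) ≤ G + G z • op T H := by
    have e1 : op T H = op T (unit z) + op T (op T H) := by
      conv_lhs => rw [hH, potential_eq, op_add]
    have e2 : op T (unit z) = fun x => K x z := by
      ext x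
      rw [op_eq_pair, pair_unit]
      simp [hT, taboo, hyz]
    have e3 : op T G ≤ fun x => op (taboo K z) G x + K x z * G z := fun x =>
      (taboo_op_le y x).trans (op_eq_taboo_add z x).le
    intro x
    have e4 : G x = h x + op (taboo K z) G x := by
      conv_lhs => rw [hG, potential_eq]
      rfl
    rw [op_add, op_smul]
    have e5 := congrFun e1 x
    rw [e2, Pi.add_apply] at e5
    simp only [Pi.add_apply, Pi.smul_apply, smul_eq_mul]
    calc h x + (op T G x + G z * op T (op T H) x)
        ≤ h x + ((op (taboo K z) G x + K x z * G z) + G z * op T (op T H) x) := by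
          gcongr
          exact e3 x
      _ = (h x + op (taboo K z) G x) + G z * (K x z + op T (op T H) x) := by ring
      _ = G x + G z * op T H x := by rw [← e4, ← e5]
  refine ne_top_of_le_ne_top ?_ (pair_mono (potential_le_of_supersolution hsuper))
  rw [pair_add, pair_smul]
  refine ENNReal.add_ne_top.2 ⟨hz, ENNReal.mul_ne_top hGz ?_⟩
  -- Pairing with `π` is the action of the matrix all of whose rows are `π`.
  have : pair π (op T H) ≤ H z := op_le_const (K := fun _ : α => π) (x := y) hπ.le
    fun w => op_le_const (hTone w) (potential_unit_le hTone z)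
  exact ne_top_of_le_ne_top hHz this

/-- A `π`-integrable subharmonic function of a chain with stationary distribution `π > 0` is
harmonic. -/
lemma op_eq_of_subharmonic (hpos : ∀ x, π x ≠ 0) (hst : ∀ h, pair π (op K h) = pair π h)
    (hh : h ≤ op K h) (hfin : pair π h ≠ ∞) : op K h = h := by
  have e : op K h = h + (op K h - h) := (add_tsub_cancel_of_le hh).symm
  have h1 := hst h
  rw [e, pair_add] at h1
  -- Stationarity and finiteness of `πh` leave no room for a positive excess.
  have h2 : pair π (op K h - h) = 0 := by
    have : pair π h + pair π (op K h - h) = pair π h + 0 := by rw [h1, add_zero]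
    exact (ENNReal.add_right_inj hfin).1 this
  have h3 : op K h - h = 0 := by
    ext x
    have := ENNReal.tsum_eq_zero.1 h2 x
    exact (mul_eq_zero.1 this).resolve_left (hpos x)
  rw [e, h3, add_zero]

/-- Since `h(d) = Kⁿh(d) ≥ Kⁿ(d,x)h(x)`, a zero at `d` spreads to every state reachable from `d`. -/
lemma eq_zero_of_harmonic (hh : op K h = h) {d : α} (hd : h d = 0)
    {x : α} (hirr : ∃ n, (op K)^[n] (unit x) d ≠ 0) : h x = 0 := by
  obtain ⟨n, hn⟩ := hirr
  have h1 := mul_iterate_op_unit_le (K := K) (h := h) n x d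
  rw [Function.iterate_fixed hh, hd, nonpos_iff_eq_zero] at h1
  exact (mul_eq_zero.1 h1).resolve_right hn

end Stationary

/-! ### The ergodic theorem through two independent copies of the chain. -/

section Ergodic

variable {α : Type*} {K : α → α → ℝ≥0∞} {π : α → ℝ≥0∞}

/-- The transition matrix of two independent copies of a chain. -/
def prodMatrix (K : α → α → ℝ≥0∞) (p q : α × α) : ℝ≥0∞ := K p.1 q.1 * K p.2 q.2

lemma op_prodMatrix (u : α × α → ℝ≥0∞) (p : α × α) :
    op (prodMatrix K) u p = op K (fun w => op K (fun w' => u (w, w')) p.2) p.1 := by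
  rw [op, ENNReal.tsum_prod']
  simp only [op, ← ENNReal.tsum_mul_left, prodMatrix, mul_assoc]

lemma op_prodMatrix_mul (u v : α → ℝ≥0∞) (p : α × α) :
    op (prodMatrix K) (fun q => u q.1 * v q.2) p = op K u p.1 * op K v p.2 := by
  rw [op_prodMatrix]
  simp only [op, ← ENNReal.tsum_mul_left, ← ENNReal.tsum_mul_right]
  rw [ENNReal.tsum_comm]
  refine tsum_congr fun w => tsum_congr fun w' => ?_
  ring

lemma iterate_op_prodMatrix_mul (n : ℕ) (u v : α → ℝ≥0∞) :
    (op (prodMatrix K))^[n] (fun q => u q.1 * v q.2)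
      = fun q => (op K)^[n] u q.1 * (op K)^[n] v q.2 := by
  induction n generalizing u v with
  | zero => rfl
  | succ n ih =>
    rw [Function.iterate_succ_apply, show op (prodMatrix K) (fun q => u q.1 * v q.2)
      = fun q => op K u q.1 * op K v q.2 from funext fun p => op_prodMatrix_mul u v p, ih]
    rfl

lemma unit_prod (p : α × α) : unit p = fun q => unit p.1 q.1 * unit p.2 q.2 := by
  ext q
  by_cases h1 : q.1 = p.1 <;> by_cases h2 : q.2 = p.2
  · rw [Prod.ext h1 h2]; simp
  · rw [unit_of_ne h2, unit_of_ne fun e => h2 (congrArg Prod.snd e), mul_zero]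
  · rw [unit_of_ne h1, unit_of_ne fun e => h1 (congrArg Prod.fst e), zero_mul]
  · rw [unit_of_ne h2, unit_of_ne fun e => h2 (congrArg Prod.snd e), mul_zero]

lemma pair_prod (u : α × α → ℝ≥0∞) :
    pair (fun p : α × α => π p.1 * π p.2) u = pair π fun w => pair π fun w' => u (w, w') := by
  rw [pair, ENNReal.tsum_prod']
  simp only [pair, ← ENNReal.tsum_mul_left, mul_assoc]

lemma op_pair_comm {β : Type*} (p : β → ℝ≥0∞) (u : α → β → ℝ≥0∞) (x : α) :
    op K (fun w => pair p (u w)) x = pair p fun b => op K (fun w => u w b) x := by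
  simp only [op, pair, ← ENNReal.tsum_mul_left]
  rw [ENNReal.tsum_comm]
  refine tsum_congr fun w => tsum_congr fun w' => ?_
  ring

lemma stationary_prod (hst : ∀ h, pair π (op K h) = pair π h) (u : α × α → ℝ≥0∞) :
    pair (fun p : α × α => π p.1 * π p.2) (op (prodMatrix K) u)
      = pair (fun p : α × α => π p.1 * π p.2) u := by
  rw [pair_prod, pair_prod]
  simp only [op_prodMatrix]
  have : ∀ w, (pair π fun w' => op K (fun v => op K (fun v' => u (v, v')) w') w)
      = op K (fun v => pair π fun v' => u (v, v')) w := by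
    intro w
    rw [← op_pair_comm π (fun v w' => op K (fun v' => u (v, v')) w')]
    simp only [hst]
  simp only [this, hst]

/-- Eventual positivity of the transition probabilities of an irreducible aperiodic chain. -/
lemma eventually_iterate_ne_zero (hirr : ∀ x w, ∃ n, (op K)^[n] (unit w) x ≠ 0)
    (hap : ∀ x, ∀ d : ℕ, (∀ n, 1 ≤ n → (op K)^[n] (unit x) x ≠ 0 → d ∣ n) → d = 1) (x w : α) :
    ∀ᶠ n in atTop, (op K)^[n] (unit w) x ≠ 0 := by
  have hmul : ∀ {m n : ℕ} {a b c : α}, (op K)^[m] (unit b) a ≠ 0 → (op K)^[n] (unit c) b ≠ 0 →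
      (op K)^[m + n] (unit c) a ≠ 0 := by
    intro m n a b c hm hn h0
    have h1 := mul_iterate_op_unit_le (K := K) (h := (op K)^[n] (unit c)) m b a
    rw [← Function.iterate_add_apply, h0, nonpos_iff_eq_zero] at h1
    exact mul_ne_zero hn hm h1
  -- The possible return times form a submonoid of gcd `1`, hence contain all large integers; a
  -- fixed path from `x` to `w` is then appended.
  let A : AddSubmonoid ℕ :=
    { carrier := {n | (op K)^[n] (unit x) x ≠ 0}
      add_mem' := fun hm hn => hmul hm hn
      zero_mem' := by simp }
  have hgcd : Nat.setGcd (A : Set ℕ) = 1 := by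
    refine hap x _ fun n _ hn => Nat.setGcd_dvd_of_mem hn
  obtain ⟨N, hN⟩ := Nat.exists_mem_closure_of_ge (A : Set ℕ)
  obtain ⟨m, hm⟩ := hirr x w
  filter_upwards [eventually_ge_atTop (N + m)] with n hn
  have h1 : n - m ∈ A := by
    have := hN (n - m) (by omega) (hgcd ▸ one_dvd _)
    rwa [AddSubmonoid.closure_eq] at this
  have := hmul h1 hm
  rwa [Nat.sub_add_cancel (by omega)] at this

/-- The ergodic theorem for irreducible aperiodic chains with a stationary distribution. -/
lemma tendsto_iterate_op_unit [Countable α] (hK : ∀ x, ∑' w, K x w = 1) (hπ : ∑' x, π x = 1)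
    (hst : ∀ h, pair π (op K h) = pair π h)
    (hirr : ∀ x w, ∃ n, (op K)^[n] (unit w) x ≠ 0)
    (hap : ∀ x, ∀ d : ℕ, (∀ n, 1 ≤ n → (op K)^[n] (unit x) x ≠ 0 → d ∣ n) → d = 1) (x w : α) :
    Tendsto (fun n => (op K)^[n] (unit w) x) atTop (𝓝 (π w)) := by
  have hpos := stationary_ne_zero hπ hst hirr
  set a : ℕ → α → ℝ≥0∞ := fun n => (op K)^[n] (unit w) with ha
  have ha1 : ∀ n x, a n x ≤ 1 := iterate_op_le_const (fun x => (hK x).le) (unit_le_one w)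
  -- Truncated subtraction makes this the positive part of the difference. The opposite sign is
  -- covered by swapping the coordinates.
  let d : ℕ → α × α → ℝ≥0∞ := fun n p => a n p.1 - a n p.2
  have hd1 : ∀ n p, d n p ≤ 1 := fun n p => tsub_le_self.trans (ha1 n p.1)
  have hopconst : ∀ (c : ℝ≥0∞) (x : α), op K (fun _ => c) x = c := fun c x => by
    rw [op, ENNReal.tsum_mul_right, hK, one_mul]
  have hK2 : ∀ p, ∑' q, prodMatrix K p q = 1 := by
    intro p
    have := op_prodMatrix_mul (K := K) (fun _ => 1) (fun _ => 1) p
    rw [hopconst, hopconst] at this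
    simpa [op] using this
  have hdstep : ∀ n p, d (n + 1) p ≤ op (prodMatrix K) (d n) p := by
    intro n p
    refine tsub_le_iff_right.2 ?_
    have e1 : a (n + 1) p.1 = op (prodMatrix K) (fun q => a n q.1) p := by
      have := op_prodMatrix_mul (K := K) (a n) (fun _ => 1) p
      simp only [mul_one, hopconst] at this
      rw [this, ha]
      exact congrFun (Function.iterate_succ_apply' _ _ _) _
    have e2 : a (n + 1) p.2 = op (prodMatrix K) (fun q => a n q.2) p := by
      have := op_prodMatrix_mul (K := K) (fun _ => 1) (a n) p
      simp only [one_mul, hopconst] at this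
      rw [this, ha]
      exact congrFun (Function.iterate_succ_apply' _ _ _) _
    rw [e1, e2, ← Pi.add_apply, ← op_add]
    exact op_mono (fun q => le_tsub_add) p
  let D : α × α → ℝ≥0∞ := fun p => limsup (fun n => d n p) atTop
  have hD1 : ∀ p, D p ≤ 1 := fun p => limsup_le_of_le (h := .of_forall fun n => hd1 n p)
  have hDsub : D ≤ op (prodMatrix K) D := by
    intro p
    have h1 : D p = limsup (fun n => d (n + 1) p) atTop :=
      (limsup_nat_add (fun n => d n p) 1).symm
    rw [h1]
    refine (limsup_le_limsup (.of_forall fun n => hdstep n p)).trans ?_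
    refine limsup_pair_le (p := prodMatrix K p) d 1 hd1 ?_
    simp [pair, hK2]
  have hπ2 : ∑' p : α × α, π p.1 * π p.2 = 1 := by
    rw [ENNReal.tsum_prod']
    simp [ENNReal.tsum_mul_left, hπ]
  have hDharm : op (prodMatrix K) D = D := by
    refine op_eq_of_subharmonic (π := fun p : α × α => π p.1 * π p.2)
      (fun p => mul_ne_zero (hpos _) (hpos _)) (stationary_prod hst) hDsub ?_
    refine ne_top_of_le_ne_top ENNReal.one_ne_top ?_
    exact op_le_const (K := fun _ p : α × α => π p.1 * π p.2) (x := (x, x)) hπ2.le hD1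
  have hD0 : ∀ p, D p = 0 := by
    intro p
    -- Aperiodicity enters here: both coordinates must reach their targets at a common time.
    refine eq_zero_of_harmonic hDharm (d := (x, x)) (by simp [D, d]) ?_
    obtain ⟨n, h1, h2⟩ := ((eventually_iterate_ne_zero hirr hap x p.1).and
      (eventually_iterate_ne_zero hirr hap x p.2)).exists
    refine ⟨n, ?_⟩
    rw [unit_prod, iterate_op_prodMatrix_mul]
    exact mul_ne_zero h1 h2
  have hd0 : ∀ p, Tendsto (fun n => d n p) atTop (𝓝 0) := fun p =>
    tendsto_of_le_liminf_of_limsup_le zero_le (hD0 p).le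
  have hpd : ∀ e : α → α × α, Tendsto (fun n => pair π fun v => d n (e v)) atTop (𝓝 0) := by
    intro e
    have : pair π (fun _ => 0) = 0 := by simp [pair]
    rw [← this]
    exact tendsto_pair_of_dominated (b := 1) (fun n v => hd1 n _) (by simp [pair, hπ])
      fun v => hd0 _
  have hconst : ∀ c : ℝ≥0∞, pair π (fun _ => c) = c := fun c => by
    rw [pair, ENNReal.tsum_mul_right, hπ, one_mul]
  have hmean : ∀ n, pair π (a n) = π w := fun n => by rw [ha, pair_iterate_op hst, pair_unit]
  have hw : π w ≠ ∞ := ne_top_of_le_ne_top ENNReal.one_ne_top (hπ ▸ ENNReal.le_tsum w)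
  -- As `π(w)` is the `π`-mean of `a n`, averaging one coordinate of `d n` compares `a n x` with
  -- `π(w)`.
  have hupper : ∀ n, a n x ≤ π w + pair π fun v => d n (x, v) := by
    intro n
    rw [← hmean n, ← pair_add, ← hconst (a n x)]
    exact pair_mono fun v => le_add_tsub
  have hlower : ∀ n, π w - (pair π fun v => d n (v, x)) ≤ a n x := by
    intro n
    refine tsub_le_iff_right.2 ?_
    rw [← hmean n, ← hconst (a n x), ← pair_add]
    exact pair_mono fun v => le_add_tsub
  refine tendsto_of_tendsto_of_tendsto_of_le_of_le ?_ ?_ hlower hupper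
  · simpa using ENNReal.Tendsto.sub (tendsto_const_nhds (x := π w)) (hpd fun v => (v, x))
      (Or.inl hw)
  · simpa using (tendsto_const_nhds (x := π w)).add (hpd fun v => (x, v))

/-- Convergence of `Kⁿ h` to `π h` for every `π`-integrable `h`. -/
lemma tendsto_iterate_op [Countable α] (hK : ∀ x, ∑' w, K x w = 1) (hπ : ∑' x, π x = 1)
    (hst : ∀ h, pair π (op K h) = pair π h)
    (hirr : ∀ x w, ∃ n, (op K)^[n] (unit w) x ≠ 0)
    (hap : ∀ x, ∀ d : ℕ, (∀ n, 1 ≤ n → (op K)^[n] (unit x) x ≠ 0 → d ∣ n) → d = 1)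
    {h : α → ℝ≥0∞} (hh : pair π h ≠ ∞) (x : α) :
    Tendsto (fun n => (op K)^[n] h x) atTop (𝓝 (pair π h)) := by
  have hx := stationary_ne_zero hπ hst hirr x
  have hx' : π x ≠ ∞ := ne_top_of_le_ne_top ENNReal.one_ne_top (hπ ▸ ENNReal.le_tsum x)
  have hcomm : ∀ n, (op K)^[n] h x = pair h fun w => (op K)^[n] (unit w) x := fun n => by
    rw [iterate_op_eq_pair]
    simp [pair, mul_comm]
  have hcomm' : pair π h = pair h π := by simp [pair, mul_comm]
  simp only [hcomm, hcomm'] at hh ⊢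
  -- With `h` as the weight, the bound comes from `π(x)Kⁿ(x,w) ≤ (πKⁿ)(w) = π(w)`.
  refine tendsto_pair_of_dominated (b := (π x)⁻¹ • π) (fun n w => ?_) ?_
    fun w => tendsto_iterate_op_unit hK hπ hst hirr hap x w
  · have := mul_le_pair (p := π) (h := (op K)^[n] (unit w)) x
    rw [pair_iterate_op hst, pair_unit] at this
    rw [Pi.smul_apply, smul_eq_mul, mul_comm, ← div_eq_mul_inv]
    exact (ENNReal.le_div_iff_mul_le (Or.inl hx) (Or.inl hx')).2 (mul_comm (π x) _ ▸ this)
  · rw [pair_smul]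
    exact ENNReal.mul_ne_top (ENNReal.inv_ne_top.2 hx) hh

end Ergodic

/-! ### From the path measure to matrices. -/

section PathLaw

variable {S : Type*}

lemma lt_returnTime_iff {z : S} {ω : ℕ → S} {j : ℕ} :
    (j : ℕ∞) < returnTime z ω ↔ ∀ i, 1 ≤ i → i ≤ j → ω i ≠ z := by
  rw [← not_le]
  refine (not_congr (hittingAfter_le_iff (u := fun (n : ℕ) (ω : ℕ → S) => ω n) (s := {z}) (n := 1)
    (i := j) (ω := ω))).trans ?_
  simp

lemma pair_pure (x : S) (h : S → ℝ≥0∞) : pair (PMF.pure x) h = h x := by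
  rw [pair, tsum_eq_single x fun w hw => by simp [PMF.pure_apply, hw]]
  simp [PMF.pure_apply]

variable [MeasurableSpace S]

lemma measurable_eval_history {i n : ℕ} (hi : i ≤ n) :
    Measurable[history n] fun ω : ℕ → S => ω i := by
  have : (fun ω : ℕ → S => ω i)
      = (fun v : Set.Iic n → S => v ⟨i, hi⟩) ∘ Preorder.restrictLe n := rfl
  rw [this]
  exact (measurable_pi_apply _).comp (comap_measurable _)

variable [DiscreteMeasurableSpace S]

instance (P : S → PMF S) (μ : PMF S) : IsProbabilityMeasure (pathLaw P μ) := by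
  unfold pathLaw; infer_instance

instance (P : S → PMF S) (x : S) : IsProbabilityMeasure (lawFrom P x) := by
  unfold lawFrom; infer_instance

/-- The transition matrix with extended nonnegative entries. -/
def matrix (P : S → PMF S) (x w : S) : ℝ≥0∞ := P x w

variable {P : S → PMF S} {μ : PMF S}

lemma measurableSet_lt_returnTime (z : S) (j : ℕ) :
    MeasurableSet[history j] {ω : ℕ → S | (j : ℕ∞) < returnTime z ω} := by
  have : {ω : ℕ → S | (j : ℕ∞) < returnTime z ω}
      = ⋂ i, ⋂ (_ : 1 ≤ i), ⋂ (_ : i ≤ j), (fun ω : ℕ → S => ω i) ⁻¹' {z}ᶜ := by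
    ext ω
    simp [lt_returnTime_iff]
  rw [this]
  refine .iInter fun i => .iInter fun _ => .iInter fun hi => ?_
  exact measurable_eval_history hi (.of_discrete)

lemma measurable_lt_returnTime_ite (z : S) (j : ℕ) (h : S → ℝ≥0∞) :
    Measurable fun ω : ℕ → S => if (j : ℕ∞) < returnTime z ω then h (ω j) else 0 :=
  Measurable.ite (history.le j _ (measurableSet_lt_returnTime z j))
    (Measurable.of_discrete.comp (measurable_pi_apply j)) measurable_const

/-- The cycle sum `∑_{j < τ(z)} h_j(X_j)` of nonnegative functions. -/
def cycleTotal (z : S) (h : ℕ → S → ℝ≥0∞) (ω : ℕ → S) : ℝ≥0∞ :=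
  ∑' j : ℕ, if (j : ℕ∞) < returnTime z ω then h j (ω j) else 0

lemma measurable_cycleTotal (z : S) (h : ℕ → S → ℝ≥0∞) : Measurable (cycleTotal z h) :=
  Measurable.tsum fun j => measurable_lt_returnTime_ite z j (h j)

lemma toENNReal_eq_tsum (n : ℕ∞) :
    (n : ℝ≥0∞) = ∑' j : ℕ, if (j : ℕ∞) < n then 1 else 0 := by
  induction n using ENat.recTopCoe with
  | top => simp
  | coe n =>
    rw [tsum_eq_sum (s := Finset.range n) fun j hj => by simpa using hj]
    rw [Finset.sum_congr rfl fun j hj => if_pos (by simpa using hj)]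
    simp

lemma ae_returnTime_ne_top {x z : S} (h : meanReturnTime P x z ≠ ∞) :
    ∀ᵐ ω ∂lawFrom P x, returnTime z ω ≠ ⊤ := by
  have hm : Measurable fun ω : ℕ → S => (returnTime z ω : ℝ≥0∞) := by
    simp only [toENNReal_eq_tsum]
    exact measurable_cycleTotal z fun _ _ => 1
  filter_upwards [ae_lt_top hm h] with ω hω e
  simp [e] at hω

/-- The signed cycle sums are integrable as soon as the expected sums of the positive and of the
negative parts are finite. -/
lemma integrable_cycleSum {x z : S} (hτ : meanReturnTime P x z ≠ ∞) (h : ℕ → S → ℝ)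
    (hp : lcycleMean P x z (fun j w => ENNReal.ofReal (h j w)) ≠ ∞)
    (hn : lcycleMean P x z (fun j w => ENNReal.ofReal (-h j w)) ≠ ∞) :
    Integrable (cycleSum z h) (lawFrom P x) ∧
      ∫ ω, cycleSum z h ω ∂lawFrom P x
        = (lcycleMean P x z (fun j w => ENNReal.ofReal (h j w))).toReal
          - (lcycleMean P x z (fun j w => ENNReal.ofReal (-h j w))).toReal := by
  have hfin : ∀ (u : ℕ → S → ℝ≥0∞) (ω : ℕ → S), returnTime z ω ≠ ⊤ →
      cycleTotal z u ω = ∑ j ∈ Finset.range (returnTime z ω).toNat, u j (ω j) := by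
    intro u ω hω
    have hc : ∀ j : ℕ, (j : ℕ∞) < returnTime z ω ↔ j ∈ Finset.range (returnTime z ω).toNat := by
      intro j
      rw [Finset.mem_range]
      conv_lhs => rw [← ENat.natCast_toNat hω, Nat.cast_lt]
    simp only [cycleTotal, hc]
    rw [tsum_eq_sum (s := Finset.range (returnTime z ω).toNat) fun j hj => if_neg hj]
    exact Finset.sum_congr rfl fun j hj => if_pos hj
  -- The default value of `cycleSum` matters only on the null event `τ(z) = ∞`; elsewhere the sums
  -- are finite and `toReal` passes through them.
  have hae : (cycleSum z h) =ᵐ[lawFrom P x] fun ω =>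
      (cycleTotal z (fun j w => ENNReal.ofReal (h j w)) ω).toReal
        - (cycleTotal z (fun j w => ENNReal.ofReal (-h j w)) ω).toReal := by
    filter_upwards [ae_returnTime_ne_top hτ] with ω hω
    rw [hfin _ ω hω, hfin _ ω hω, ENNReal.toReal_sum (fun _ _ => ENNReal.ofReal_ne_top),
      ENNReal.toReal_sum (fun _ _ => ENNReal.ofReal_ne_top), ← Finset.sum_sub_distrib]
    refine Finset.sum_congr rfl fun j _ => ?_
    rw [ENNReal.toReal_ofReal', ENNReal.toReal_ofReal', max_zero_sub_max_neg_zero_eq_self]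
  have hp' : ∫⁻ ω, cycleTotal z (fun j w => ENNReal.ofReal (h j w)) ω ∂lawFrom P x ≠ ∞ := hp
  have hn' : ∫⁻ ω, cycleTotal z (fun j w => ENNReal.ofReal (-h j w)) ω ∂lawFrom P x ≠ ∞ := hn
  have ip := integrable_toReal_of_lintegral_ne_top (measurable_cycleTotal z _).aemeasurable hp'
  have iN := integrable_toReal_of_lintegral_ne_top (measurable_cycleTotal z _).aemeasurable hn'
  refine ⟨(ip.sub iN).congr hae.symm, ?_⟩
  rw [integral_congr_ae hae, integral_sub ip iN,
    integral_toReal (measurable_cycleTotal z _).aemeasurable (ae_lt_top (measurable_cycleTotal z _) hp'),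
    integral_toReal (measurable_cycleTotal z _).aemeasurable (ae_lt_top (measurable_cycleTotal z _) hn')]
  rfl

variable [Countable S]

lemma lintegral_toMeasure (p : PMF S) (h : S → ℝ≥0∞) : ∫⁻ x, h x ∂p.toMeasure = pair p h := by
  rw [lintegral_countable']
  refine tsum_congr fun x => ?_
  rw [PMF.toMeasure_apply_singleton _ _ .of_discrete, mul_comm]

lemma lintegral_eval_zero (h : S → ℝ≥0∞) : ∫⁻ ω, h (ω 0) ∂pathLaw P μ = pair μ h := by
  have e : (pathLaw P μ).map (Preorder.frestrictLe (π := fun _ => S) 0)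
      = μ.toMeasure.map (MeasurableEquiv.piUnique fun _ : Finset.Iic 0 => S).symm := by
    rw [pathLaw, Kernel.trajMeasure, Measure.map_comp _ _ (by fun_prop),
      Kernel.traj_map_frestrictLe, Kernel.partialTraj_self, Measure.id_comp]
  have e1 : ∫⁻ ω, h (ω 0) ∂pathLaw P μ
      = ∫⁻ v, h (v ⟨0, Finset.mem_Iic.2 le_rfl⟩)
        ∂(pathLaw P μ).map (Preorder.frestrictLe (π := fun _ => S) 0) := by
    rw [lintegral_map .of_discrete (by fun_prop)]
    rfl
  rw [e1, e, lintegral_map .of_discrete (by fun_prop),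
    ← lintegral_toMeasure]
  rfl

/-- The Markov property at time `n`. -/
lemma setLIntegral_eval_succ {n : ℕ} {A : Set (ℕ → S)} (hA : MeasurableSet[history n] A)
    (h : S → ℝ≥0∞) :
    ∫⁻ ω in A, h (ω (n + 1)) ∂pathLaw P μ = ∫⁻ ω in A, op (matrix P) h (ω n) ∂pathLaw P μ := by
  have hA' := history.le n A hA
  have hA2 : MeasurableSet[MeasurableSpace.pi.comap
      (Preorder.frestrictLe (π := fun _ => S) n)] A := by
    rw [← Filtration.piLE_eq_comap_frestrictLe (X := fun _ => S) n]
    exact hA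
  obtain ⟨B, hB, rfl⟩ := hA2
  -- The joint law of the history and of the next state is tested against `1_B ⊗ h`.
  let F : (Finset.Iic n → S) × S → ℝ≥0∞ := fun q => B.indicator 1 q.1 * h q.2
  have hF : Measurable F := by
    refine Measurable.mul ?_ (Measurable.of_discrete.comp measurable_snd)
    exact (measurable_one.indicator hB).comp measurable_fst
  have key := Kernel.map_frestrictLe_trajMeasure_compProd_eq_map_trajMeasure
    (X := fun _ => S) (μ₀ := μ.toMeasure) (κ := historyKernel P) (a := n)
  change (pathLaw P μ).map (Preorder.frestrictLe (π := fun _ => S) n) ⊗ₘ historyKernel P n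
    = (pathLaw P μ).map _ at key
  have h1 := congrArg (fun m => ∫⁻ q, F q ∂m) key
  beta_reduce at h1
  rw [Measure.lintegral_compProd hF, lintegral_map hF (by fun_prop),
    lintegral_map (Measurable.lintegral_kernel_prod_right' hF) (by fun_prop)] at h1
  have h2 : ∀ v, ∫⁻ w, F (v, w) ∂historyKernel P n v
      = B.indicator 1 v * op (matrix P) h (v ⟨n, Finset.mem_Iic.2 le_rfl⟩) := by
    intro v
    simp only [F]
    rw [lintegral_const_mul _ .of_discrete]
    congr 1
    exact lintegral_toMeasure _ _
  have h3 : ∀ u : (ℕ → S) → ℝ≥0∞,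
      ∫⁻ ω in Preorder.frestrictLe n ⁻¹' B, u ω ∂pathLaw P μ
        = ∫⁻ ω, B.indicator 1 (Preorder.frestrictLe n ω) * u ω ∂pathLaw P μ := by
    intro u
    rw [← lintegral_indicator hA']
    refine lintegral_congr fun ω => ?_
    by_cases hω : Preorder.frestrictLe n ω ∈ B <;> simp [Set.indicator, hω]
  rw [h3, h3]
  simp only [h2, F] at h1
  exact h1.symm

lemma lintegral_eval (n : ℕ) (h : S → ℝ≥0∞) :
    ∫⁻ ω, h (ω n) ∂pathLaw P μ = pair μ ((op (matrix P))^[n] h) := by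
  induction n generalizing h with
  | zero => exact lintegral_eval_zero h
  | succ n ih =>
    rw [Function.iterate_succ_apply, ← ih]
    simpa using setLIntegral_eval_succ (P := P) (μ := μ) (n := n) MeasurableSet.univ h

/-- By the Markov property, forbidding `X_{j+1} = z` deletes the column of `z`. At `j = 0` nothing
is forbidden, even for a start at `z`, because `τ(z) ≥ 1`. -/
lemma setLIntegral_lt_returnTime (z : S) (j : ℕ) (h : S → ℝ≥0∞) :
    ∫⁻ ω in {ω | (j : ℕ∞) < returnTime z ω}, h (ω j) ∂pathLaw P μ
      = pair μ ((op (taboo (matrix P) z))^[j] h) := by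
  induction j generalizing h with
  | zero =>
    have : {ω : ℕ → S | ((0 : ℕ) : ℕ∞) < returnTime z ω} = Set.univ := by
      ext ω
      simp only [Set.mem_ofPred_eq, Set.mem_univ, iff_true, lt_returnTime_iff]
      omega
    rw [this, setLIntegral_univ]
    exact lintegral_eval_zero h
  | succ j ih =>
    classical
    let A := {ω : ℕ → S | (j : ℕ∞) < returnTime z ω}
    have hA : MeasurableSet[history j] A := measurableSet_lt_returnTime z j
    have e1 : {ω : ℕ → S | ((j + 1 : ℕ) : ℕ∞) < returnTime z ω}
        = (fun ω => ω (j + 1)) ⁻¹' {z}ᶜ ∩ A := by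
      ext ω
      simp only [A, Set.mem_ofPred_eq, Set.mem_inter_iff, lt_returnTime_iff, Set.mem_preimage,
        Set.mem_compl_iff, Set.mem_singleton_iff]
      refine ⟨fun hω => ⟨hω _ (by omega) le_rfl, fun i h1 h2 => hω i h1 (by omega)⟩,
        fun hω i h1 h2 => ?_⟩
      rcases Nat.lt_or_ge j i with hi | hi
      · obtain rfl : i = j + 1 := by omega
        exact hω.1
      · exact hω.2 i h1 hi
    have hm : MeasurableSet ((fun ω : ℕ → S => ω (j + 1)) ⁻¹' {z}ᶜ) :=
      measurable_pi_apply _ .of_discrete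
    rw [e1, ← Measure.restrict_restrict hm, ← lintegral_indicator hm]
    have e2 : ∀ ω : ℕ → S, ((fun ω : ℕ → S => ω (j + 1)) ⁻¹' {z}ᶜ).indicator
        (fun ω => h (ω (j + 1))) ω = (fun w => if w = z then 0 else h w) (ω (j + 1)) := by
      intro ω
      by_cases hω : ω (j + 1) = z <;> simp [Set.indicator, hω]
    simp only [e2]
    rw [setLIntegral_eval_succ hA fun w => if w = z then 0 else h w, Function.iterate_succ_apply,
      ← ih]
    refine lintegral_congr fun ω => tsum_congr fun w => ?_
    by_cases hw : w = z <;> simp [taboo, hw]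

lemma lcycleMean_eq (x z : S) (h : ℕ → S → ℝ≥0∞) :
    lcycleMean P x z h = ∑' j, (op (taboo (matrix P) z))^[j] (h j) x := by
  rw [lcycleMean, lintegral_tsum fun j => (measurable_lt_returnTime_ite z j (h j)).aemeasurable]
  refine tsum_congr fun j => ?_
  rw [← pair_pure x ((op (taboo (matrix P) z))^[j] (h j)), ← setLIntegral_lt_returnTime,
    ← lintegral_indicator (history.le j _ (measurableSet_lt_returnTime z j))]
  refine lintegral_congr fun ω => ?_
  by_cases hω : (j : ℕ∞) < returnTime z ω <;> simp [Set.indicator, hω]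

lemma meanReturnTime_eq (x z : S) :
    meanReturnTime P x z = potential (taboo (matrix P) z) 1 x := by
  have := lcycleMean_eq (P := P) x z fun _ => 1
  rw [lcycleMean] at this
  simp only [meanReturnTime, toENNReal_eq_tsum]
  exact this

/-- The real-valued function `u - v` of the chain at time `n`. -/
lemma integrable_eval_sub {u v : S → ℝ≥0∞} {n : ℕ} (hu : pair μ ((op (matrix P))^[n] u) ≠ ∞)
    (hv : pair μ ((op (matrix P))^[n] v) ≠ ∞) :
    Integrable (fun ω : ℕ → S => (u (ω n)).toReal - (v (ω n)).toReal) (pathLaw P μ) ∧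
      ∀ A : Set (ℕ → S), ∫ ω in A, ((u (ω n)).toReal - (v (ω n)).toReal) ∂pathLaw P μ
        = (∫⁻ ω in A, u (ω n) ∂pathLaw P μ).toReal
          - (∫⁻ ω in A, v (ω n) ∂pathLaw P μ).toReal := by
  have hm : ∀ u : S → ℝ≥0∞, Measurable fun ω : ℕ → S => u (ω n) := fun u =>
    Measurable.of_discrete.comp (measurable_pi_apply n)
  rw [← lintegral_eval] at hu hv
  have iu := integrable_toReal_of_lintegral_ne_top (hm u).aemeasurable hu
  have iv := integrable_toReal_of_lintegral_ne_top (hm v).aemeasurable hv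
  refine ⟨iu.sub iv, fun A => ?_⟩
  rw [integral_sub iu.integrableOn iv.integrableOn,
    integral_toReal (hm u).aemeasurable (ae_restrict_of_ae (ae_lt_top (hm u) hu)),
    integral_toReal (hm v).aemeasurable (ae_restrict_of_ae (ae_lt_top (hm v) hv))]

end PathLaw

/-! ### Real-valued means under the stationary distribution. -/

section Mean

variable {S : Type*} {π : PMF S}

lemma memL1_toReal_sub {u v : S → ℝ≥0∞} (hu : pair π u ≠ ∞) (hv : pair π v ≠ ∞) :
    MemL1 π (fun x => (u x).toReal - (v x).toReal) ∧
      mean π (fun x => (u x).toReal - (v x).toReal) = (pair π u).toReal - (pair π v).toReal := by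
  have hs : ∀ {u : S → ℝ≥0∞}, pair π u ≠ ∞ →
      HasSum (fun x => (π x).toReal * (u x).toReal) (pair π u).toReal := by
    intro u hu
    simp only [← ENNReal.toReal_mul]
    rw [pair, ENNReal.tsum_toReal_eq fun x => ENNReal.ne_top_of_tsum_ne_top hu x]
    exact ENNReal.hasSum_toReal hu
  refine ⟨Summable.of_nonneg_of_le (fun x => by positivity) (fun x => ?_)
    ((hs hu).add (hs hv)).summable, ?_⟩
  · rw [← mul_add]
    gcongr
    refine (abs_sub _ _).trans ?_
    rw [abs_of_nonneg ENNReal.toReal_nonneg, abs_of_nonneg ENNReal.toReal_nonneg]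
  · rw [mean]
    simp only [mul_sub]
    exact ((hs hu).sub (hs hv)).tsum_eq

lemma ofReal_toReal_sub (a : ℝ) : (ENNReal.ofReal a).toReal - (ENNReal.ofReal (-a)).toReal = a := by
  rw [ENNReal.toReal_ofReal', ENNReal.toReal_ofReal', max_zero_sub_max_neg_zero_eq_self]

lemma MemL1.pair_abs_ne_top {h : S → ℝ} (hh : MemL1 π h) :
    pair π (fun x => ENNReal.ofReal |h x|) ≠ ∞ := by
  have := hh.tsum_ofReal_ne_top
  refine ne_of_eq_of_ne (tsum_congr fun x => ?_) this
  rw [ENNReal.ofReal_mul ENNReal.toReal_nonneg, ENNReal.ofReal_toReal (π.apply_ne_top x)]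

lemma MemL1.summable {h : S → ℝ} (hh : MemL1 π h) : Summable fun x => (π x).toReal * h x := by
  refine Summable.of_norm (hh.congr fun x => ?_)
  rw [norm_mul, Real.norm_of_nonneg ENNReal.toReal_nonneg, Real.norm_eq_abs]

lemma hasSum_pmf_toReal (π : PMF S) : HasSum (fun x => (π x).toReal) 1 := by
  have := ENNReal.hasSum_toReal π.tsum_coe_ne_top
  rwa [← ENNReal.tsum_toReal_eq π.apply_ne_top, π.tsum_coe, ENNReal.toReal_one] at this

lemma MemL1.centered {h : S → ℝ} (hh : MemL1 π h) : MemL1 π (centered π h) := by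
  refine Summable.of_nonneg_of_le (fun x => by positivity) (fun x => ?_)
    (hh.add ((hasSum_pmf_toReal π).summable.mul_right |mean π h|))
  rw [← mul_add]
  gcongr
  exact abs_sub _ _

lemma mean_centered {h : S → ℝ} (hh : MemL1 π h) : mean π (PoissonChain.centered π h) = 0 := by
  have h1 := hh.summable.hasSum.sub ((hasSum_pmf_toReal π).mul_right (mean π h))
  have : mean π (PoissonChain.centered π h) = mean π h - 1 * mean π h := by
    refine Eq.trans (tsum_congr fun x => ?_) h1.tsum_eq
    rw [PoissonChain.centered, mul_sub]
  rw [this, one_mul, sub_self]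

end Mean

/-! ### The Poisson equation and the martingale. -/

section Poisson

variable {S : Type*} {P : S → PMF S} {π : PMF S}

lemma tsum_matrix (x : S) : ∑' w, matrix P x w = 1 := (P x).tsum_coe

lemma IsStationary.pair_op (hπ : IsStationary P π) (h : S → ℝ≥0∞) :
    pair π (op (matrix P) h) = pair π h := by
  have e : ∀ w, π w = ∑' x, π x * P x w := fun w => by
    conv_lhs => rw [← hπ, PMF.bind_apply]
  simp only [pair, op, ← ENNReal.tsum_mul_left]
  rw [ENNReal.tsum_comm]
  refine tsum_congr fun w => ?_
  conv_rhs => rw [e w, ← ENNReal.tsum_mul_right]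
  exact tsum_congr fun x => (mul_assoc _ _ _).symm

/-- `E_x ∑_{j < τ(y)} u(X_j)` for the nonnegative function `u`. -/
def cyclePotential (P : S → PMF S) (y : S) (u : S → ℝ≥0∞) : S → ℝ≥0∞ :=
  potential (taboo (matrix P) y) u

/-- The Poisson equation with a defect, written without subtraction. The defect depends on `u` only
through the potential at `y`, so it can cancel between the parts of `f_c`. -/
lemma op_cyclePotential_add (y : S) (u : S → ℝ≥0∞) (x : S) :
    op (matrix P) (cyclePotential P y u) x + u x
      = cyclePotential P y u x + P x y * cyclePotential P y u y := by
  have h1 : cyclePotential P y u x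
      = u x + op (taboo (matrix P) y) (cyclePotential P y u) x :=
    congrFun (potential_eq (K := taboo (matrix P) y) u) x
  rw [op_eq_taboo_add y]
  conv_rhs => rw [h1]
  change _ + matrix P x y * _ + _ = _ + _ + matrix P x y * _
  ring

variable [MeasurableSpace S] [DiscreteMeasurableSpace S]

lemma stronglyAdapted_poissonMartingale (f : S → ℝ) (y : S) :
    StronglyAdapted history (poissonMartingale P π f y) := by
  intro n
  have hm : ∀ (g : S → ℝ) {i}, i ≤ n → Measurable[history n] fun ω : ℕ → S => g (ω i) :=
    fun g i hi => (Measurable.of_discrete (f := g)).comp (measurable_eval_history hi)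
  refine Measurable.stronglyMeasurable ?_
  refine Measurable.add (hm _ le_rfl) ?_
  exact Finset.measurable_fun_sum _ fun i hi => hm _ (Finset.mem_range.1 hi).le

variable [Countable S]

lemma lawFrom_eval_eq (x y : S) (n : ℕ) :
    lawFrom P x {ω | ω n = y} = (op (matrix P))^[n] (unit y) x := by
  have h1 := lintegral_eval (P := P) (μ := PMF.pure x) n (unit y)
  have hm : MeasurableSet {ω : ℕ → S | ω n = y} :=
    measurable_pi_apply (X := fun _ => S) n (MeasurableSet.of_discrete (s := {y}))
  rw [pair_pure] at h1
  rw [← h1, lawFrom, ← lintegral_indicator_one hm]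
  rfl

lemma cyclePotential_eq_lcycleMean (x y : S) (u : S → ℝ≥0∞) :
    cyclePotential P y u x = lcycleMean P x y fun _ => u := (lcycleMean_eq x y _).symm

/-- The initial law is general because both `π` and the point masses are needed. -/
lemma martingale_poissonMartingale {f : S → ℝ} {y : S} {μ : PMF S}
    (hsol : ∀ x, poissonSol P π f y x
      = (cyclePotential P y (fun w => ENNReal.ofReal (centered π f w)) x).toReal
        - (cyclePotential P y (fun w => ENNReal.ofReal (-centered π f w)) x).toReal)
    (hfin : ∀ n, pair μ ((op (matrix P))^[n]
      (cyclePotential P y fun w => ENNReal.ofReal |centered π f w|)) ≠ ∞)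
    (hy : cyclePotential P y (fun w => ENNReal.ofReal (centered π f w)) y
      = cyclePotential P y (fun w => ENNReal.ofReal (-centered π f w)) y)
    (hy_top : cyclePotential P y (fun w => ENNReal.ofReal (centered π f w)) y ≠ ∞) :
    Martingale (poissonMartingale P π f y) history (pathLaw P μ) := by
  set fp : S → ℝ≥0∞ := fun w => ENNReal.ofReal (centered π f w) with hfp
  set fn : S → ℝ≥0∞ := fun w => ENNReal.ofReal (-centered π f w) with hfn
  set fa : S → ℝ≥0∞ := fun w => ENNReal.ofReal |centered π f w| with hfa
  have hle : ∀ {u : S → ℝ≥0∞}, u ≤ cyclePotential P y fa →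
      ∀ n, pair μ ((op (matrix P))^[n] u) ≠ ∞ := fun hu n =>
    ne_top_of_le_ne_top (hfin n) (pair_mono (iterate_op_mono n hu))
  have hpa : fp ≤ fa := fun w => ENNReal.ofReal_le_ofReal (le_abs_self _)
  have hna : fn ≤ fa := fun w => ENNReal.ofReal_le_ofReal (neg_le_abs _)
  have hGp : ∀ n, pair μ ((op (matrix P))^[n] (cyclePotential P y fp)) ≠ ∞ :=
    hle (potential_mono (K := taboo (matrix P) y) hpa)
  have hGn : ∀ n, pair μ ((op (matrix P))^[n] (cyclePotential P y fn)) ≠ ∞ :=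
    hle (potential_mono (K := taboo (matrix P) y) hna)
  have hFp := hle (hpa.trans (le_potential (K := taboo (matrix P) y)))
  have hFn := hle (hna.trans (le_potential (K := taboo (matrix P) y)))
  have hsol' : poissonSol P π f y
      = fun x => (cyclePotential P y fp x).toReal - (cyclePotential P y fn x).toReal := funext hsol
  have hcent : centered π f = fun x => (fp x).toReal - (fn x).toReal :=
    funext fun x => (ofReal_toReal_sub _).symm
  have ig : ∀ n, Integrable (fun ω : ℕ → S => poissonSol P π f y (ω n)) (pathLaw P μ) := fun n => by
    rw [hsol']
    exact (integrable_eval_sub (hGp n) (hGn n)).1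
  have ic : ∀ n, Integrable (fun ω : ℕ → S => centered π f (ω n)) (pathLaw P μ) := fun n => by
    rw [hcent]
    exact (integrable_eval_sub (hFp n) (hFn n)).1
  have iM : ∀ n, Integrable (poissonMartingale P π f y n) (pathLaw P μ) := fun n =>
    (ig n).add (integrable_finsetSum _ fun i _ => ic i)
  refine martingale_of_setIntegral_eq_succ (stronglyAdapted_poissonMartingale f y) iM
    fun n A hA => ?_
  have hstep : ∫ ω in A, poissonSol P π f y (ω n) ∂pathLaw P μ
      = ∫ ω in A, poissonSol P π f y (ω (n + 1)) ∂pathLaw P μ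
        + ∫ ω in A, centered π f (ω n) ∂pathLaw P μ := by
    have hne : ∀ {u : S → ℝ≥0∞} {k : ℕ}, pair μ ((op (matrix P))^[k] u) ≠ ∞ →
        ∫⁻ ω in A, u (ω k) ∂pathLaw P μ ≠ ∞ := fun {u k} hu =>
      ne_top_of_le_ne_top (lintegral_eval (P := P) (μ := μ) k u ▸ hu) (setLIntegral_le_lintegral _ _)
    have hm : ∀ (u : S → ℝ≥0∞) (k : ℕ), Measurable fun ω : ℕ → S => u (ω k) := fun u k =>
      Measurable.of_discrete.comp (measurable_pi_apply k)
    set c := cyclePotential P y fp y with hc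
    -- The integrated defect, finite and common to both parts, drops out of the difference of the
    -- two balances.
    set e := ∫⁻ ω in A, P (ω n) y * c ∂pathLaw P μ with he
    have he_top : e ≠ ∞ := by
      refine ne_top_of_le_ne_top hy_top (?_ : e ≤ c)
      calc e ≤ ∫⁻ ω, c ∂pathLaw P μ := by
            refine (setLIntegral_le_lintegral _ _).trans (lintegral_mono fun ω => ?_)
            exact (mul_le_mul_left ((P (ω n)).coe_le_one y) c).trans_eq (one_mul c)
        _ = c := by simp
    have hbal : ∀ u : S → ℝ≥0∞, cyclePotential P y u y = c →
        ∫⁻ ω in A, cyclePotential P y u (ω (n + 1)) ∂pathLaw P μ + ∫⁻ ω in A, u (ω n) ∂pathLaw P μ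
          = ∫⁻ ω in A, cyclePotential P y u (ω n) ∂pathLaw P μ + e := by
      intro u hu
      rw [setLIntegral_eval_succ hA, ← lintegral_add_left (hm _ n), he, ← lintegral_add_left (hm _ n)]
      refine lintegral_congr fun ω => ?_
      rw [op_cyclePotential_add, hu]
    have bp := congrArg ENNReal.toReal (hbal fp rfl)
    have bn := congrArg ENNReal.toReal (hbal fn hy.symm)
    rw [ENNReal.toReal_add (hne (hGp _)) (hne (hFp _)), ENNReal.toReal_add (hne (hGp _)) he_top] at bp
    rw [ENNReal.toReal_add (hne (hGn _)) (hne (hFn _)), ENNReal.toReal_add (hne (hGn _)) he_top] at bn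
    rw [hsol', hcent, (integrable_eval_sub (hGp n) (hGn n)).2 A,
      (integrable_eval_sub (hGp (n + 1)) (hGn (n + 1))).2 A,
      (integrable_eval_sub (hFp n) (hFn n)).2 A]
    linarith
  have hM : poissonMartingale P π f y n
      = fun ω => poissonSol P π f y (ω n) + partialSum (centered π f) n ω := rfl
  have hM' : poissonMartingale P π f y (n + 1) = fun ω => poissonSol P π f y (ω (n + 1))
      + (partialSum (centered π f) n ω + centered π f (ω n)) :=
    funext fun ω => congrArg _ (Finset.sum_range_succ _ _)
  have iS : Integrable (partialSum (centered π f) n) (pathLaw P μ) :=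
    integrable_finsetSum _ fun i _ => ic i
  have iS' : Integrable (fun ω : ℕ → S => partialSum (centered π f) n ω + centered π f (ω n))
      (pathLaw P μ) := iS.add (ic n)
  rw [hM, hM', integral_add (ig n).integrableOn iS.integrableOn,
    integral_add (ig (n + 1)).integrableOn iS'.integrableOn,
    integral_add iS.integrableOn (ic n).integrableOn, hstep]
  ring

end Poisson

/-! ### Consequences of the probabilistic hypotheses. -/

section MainFacts

variable {S : Type*} [Countable S] [MeasurableSpace S] [DiscreteMeasurableSpace S]
  {P : S → PMF S} {π : PMF S}

lemma IsIrreducible.exists_iterate_ne_zero (hirr : IsIrreducible P) (x w : S) :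
    ∃ n, (op (matrix P))^[n] (unit w) x ≠ 0 := by
  obtain ⟨n, hn⟩ := hirr x w
  exact ⟨n, by rw [← lawFrom_eval_eq]; exact hn.ne'⟩

lemma IsPositiveRecurrent.cyclePotential_one_ne_top (hrec : IsPositiveRecurrent P) (y : S) :
    cyclePotential P y 1 y ≠ ∞ := by
  rw [cyclePotential, ← meanReturnTime_eq]
  exact (hrec y).ne

lemma IsAperiodic.eq_one_of_dvd (hap : IsAperiodic P) (x : S) (d : ℕ)
    (hd : ∀ n, 1 ≤ n → (op (matrix P))^[n] (unit x) x ≠ 0 → d ∣ n) : d = 1 :=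
  hap x d fun n hn hpos => hd n hn <| by rw [← lawFrom_eval_eq]; exact hpos.ne'

lemma lcycleMean_mul_eq (x z : S) (c : ℕ → ℝ≥0∞) (u : S → ℝ≥0∞) :
    lcycleMean P x z (fun j w => c j * u w)
      = ∑' j, c j * (op (taboo (matrix P) z))^[j] u x := by
  rw [lcycleMean_eq]
  refine tsum_congr fun j => ?_
  exact congrFun (iterate_op_smul (K := taboo (matrix P) z) (h := u) j (c j)) x

lemma lcycleMean_succ_mul (x z : S) (u : S → ℝ≥0∞) :
    lcycleMean P x z (fun j w => ((j : ℝ≥0∞) + 1) * u w)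
      = cyclePotential P z (cyclePotential P z u) x := by
  rw [lcycleMean_mul_eq, cyclePotential, cyclePotential, potential_potential]

lemma ofReal_succ_mul (j : ℕ) (a : ℝ) :
    ENNReal.ofReal (((j : ℝ) + 1) * a) = ((j : ℝ≥0∞) + 1) * ENNReal.ofReal a := by
  rw [ENNReal.ofReal_mul (by positivity), ENNReal.ofReal_add (by positivity) zero_le_one,
    ENNReal.ofReal_natCast, ENNReal.ofReal_one]

lemma cycle_formula (hirr : IsIrreducible P) (hrec : IsPositiveRecurrent P)
    (hπ : IsStationary P π) (y : S) (u : S → ℝ≥0∞) :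
    pair π u = π y * cyclePotential P y u y :=
  pair_eq_potential tsum_matrix π.tsum_coe hπ.pair_op hirr.exists_iterate_ne_zero
    (hrec.cyclePotential_one_ne_top y) u

lemma apply_ne_zero_of_isStationary (hirr : IsIrreducible P) (hπ : IsStationary P π) (x : S) :
    π x ≠ 0 :=
  stationary_ne_zero π.tsum_coe hπ.pair_op hirr.exists_iterate_ne_zero x

lemma meanReturnTime_ne_top (hirr : IsIrreducible P) (hrec : IsPositiveRecurrent P) (x y : S) :
    meanReturnTime P x y ≠ ∞ := by
  rw [meanReturnTime_eq]
  exact potential_taboo_one_ne_top tsum_matrix hirr.exists_iterate_ne_zero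
    (hrec.cyclePotential_one_ne_top y) x

/-- At `z` the cycle formula gives `π(z) ∑ⱼ (j+1) Tʲ|h|(z)`: `hz` bounds the part with weight `j`,
and the part with weight `1` is `π|h|/π(z)`. -/
lemma pair_cyclePotential_ne_top (hirr : IsIrreducible P) (hrec : IsPositiveRecurrent P)
    (hπ : IsStationary P π) {h : S → ℝ} (hh : MemL1 π h) {z : S}
    (hz : lcycleMean P z z (fun j x => ENNReal.ofReal ((j : ℝ) * |h x|)) < ∞) (y : S) :
    pair π (cyclePotential P y fun x => ENNReal.ofReal |h x|) ≠ ∞ := by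
  have hpos := apply_ne_zero_of_isStationary hirr hπ
  refine pair_potential_ne_top tsum_matrix π.tsum_coe hπ.pair_op hirr.exists_iterate_ne_zero
    hrec.cyclePotential_one_ne_top (z := z) ?_ y
  change pair π (cyclePotential P z _) ≠ ∞
  rw [cycle_formula hirr hrec hπ z]
  refine ENNReal.mul_ne_top (π.apply_ne_top z) ?_
  rw [← lcycleMean_succ_mul, lcycleMean_mul_eq]
  simp only [ENNReal.ofReal_mul (Nat.cast_nonneg _), ENNReal.ofReal_natCast] at hz
  rw [lcycleMean_mul_eq] at hz
  simp only [add_mul, one_mul]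
  rw [ENNReal.tsum_add]
  refine ENNReal.add_ne_top.2 ⟨hz.ne, fun e => hh.pair_abs_ne_top ?_⟩
  rw [cycle_formula hirr hrec hπ z, cyclePotential, potential, e, ENNReal.mul_top (hpos z)]

end MainFacts

end PoissonChain

end

/-! ### The main theorem. -/

theorem theorem3 {S : Type*} [Countable S] [MeasurableSpace S] [DiscreteMeasurableSpace S]
    (P : S → PMF S) (hirr : PoissonChain.IsIrreducible P)
    (hrec : PoissonChain.IsPositiveRecurrent P)
    (π : PMF S) (hπ : PoissonChain.IsStationary P π)
    (f : S → ℝ) (hf : PoissonChain.MemL1 π f) (z : S)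
    (hz : PoissonChain.lcycleMean P z z
      (fun j x => ENNReal.ofReal ((j : ℝ) * |PoissonChain.centered π f x|)) < ∞) :
    -- the expectations defining `g_y(x)` exist
    (∀ x y, Integrable (PoissonChain.cycleSum y (fun _ => PoissonChain.centered π f))
      (PoissonChain.lawFrom P x)) ∧
    (∀ y, PoissonChain.MemL1 π (PoissonChain.poissonSol P π f y)) ∧
    (∀ y, Martingale (PoissonChain.poissonMartingale P π f y) PoissonChain.history
      (PoissonChain.pathLaw P π)) ∧
    (PoissonChain.IsAperiodic P →
      -- the formula for `π g_z`, whose numerator is a genuine expectation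
      (Integrable (PoissonChain.cycleSum z
          (fun j x => ((j : ℝ) + 1) * PoissonChain.centered π f x)) (PoissonChain.lawFrom P z) ∧
        PoissonChain.mean π (PoissonChain.poissonSol P π f z) =
          (∫ ω, PoissonChain.cycleSum z
            (fun j x => ((j : ℝ) + 1) * PoissonChain.centered π f x) ω
              ∂(PoissonChain.lawFrom P z)) / (PoissonChain.meanReturnTime P z z).toReal) ∧
      ∀ x,
        -- `E_x g_z(X_n) → π g_z`
        ((∀ n : ℕ, Integrable (fun ω : ℕ → S => PoissonChain.poissonSol P π f z (ω n))
            (PoissonChain.lawFrom P x)) ∧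
          Tendsto (fun n : ℕ => ∫ ω, PoissonChain.poissonSol P π f z (ω n)
              ∂(PoissonChain.lawFrom P x)) atTop
            (𝓝 (PoissonChain.mean π (PoissonChain.poissonSol P π f z)))) ∧
        -- `E_x S_n(f) = n π f + g_z(x) - π g_z + o(1)`
        ((∀ n : ℕ, Integrable (PoissonChain.partialSum f n) (PoissonChain.lawFrom P x)) ∧
          Tendsto (fun n : ℕ => (∫ ω, PoissonChain.partialSum f n ω ∂(PoissonChain.lawFrom P x)) -
              ((n : ℝ) * PoissonChain.mean π f + PoissonChain.poissonSol P π f z x -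
                PoissonChain.mean π (PoissonChain.poissonSol P π f z))) atTop (𝓝 0))) := by
  have hpos := PoissonChain.apply_ne_zero_of_isStationary hirr hπ
  set fc := PoissonChain.centered π f with hfc
  set fp : S → ℝ≥0∞ := fun w => ENNReal.ofReal (fc w) with hfp
  set fn : S → ℝ≥0∞ := fun w => ENNReal.ofReal (-fc w) with hfn
  set fa : S → ℝ≥0∞ := fun w => ENNReal.ofReal |fc w| with hfa
  have hcL1 : PoissonChain.MemL1 π fc := hf.centered
  have hpa : fp ≤ fa := fun w => ENNReal.ofReal_le_ofReal (le_abs_self _)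
  have hna : fn ≤ fa := fun w => ENNReal.ofReal_le_ofReal (neg_le_abs _)
  have hGa := PoissonChain.pair_cyclePotential_ne_top hirr hrec hπ hcL1 hz
  have hGp : ∀ y, PoissonChain.pair π (PoissonChain.cyclePotential P y fp) ≠ ∞ := fun y =>
    ne_top_of_le_ne_top (hGa y) (PoissonChain.pair_mono (PoissonChain.potential_mono hpa))
  have hGn : ∀ y, PoissonChain.pair π (PoissonChain.cyclePotential P y fn) ≠ ∞ := fun y =>
    ne_top_of_le_ne_top (hGa y) (PoissonChain.pair_mono (PoissonChain.potential_mono hna))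
  have hGp_top := fun x y => PoissonChain.ne_top_of_pair_ne_top hpos (hGp y) x
  have hGn_top := fun x y => PoissonChain.ne_top_of_pair_ne_top hpos (hGn y) x
  have hfa_top := hcL1.pair_abs_ne_top
  have hfp_top := ne_top_of_le_ne_top hfa_top (PoissonChain.pair_mono hpa)
  have hfn_top := ne_top_of_le_ne_top hfa_top (PoissonChain.pair_mono hna)
  have hτ := PoissonChain.meanReturnTime_ne_top hirr hrec
  have hsol : ∀ x y, Integrable (PoissonChain.cycleSum y fun _ => fc) (PoissonChain.lawFrom P x) ∧
      PoissonChain.poissonSol P π f y x = (PoissonChain.cyclePotential P y fp x).toReal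
        - (PoissonChain.cyclePotential P y fn x).toReal := by
    intro x y
    rw [PoissonChain.cyclePotential_eq_lcycleMean, PoissonChain.cyclePotential_eq_lcycleMean]
    refine PoissonChain.integrable_cycleSum (hτ x y) (fun _ => fc) ?_ ?_
    · exact PoissonChain.cyclePotential_eq_lcycleMean (P := P) x y fp ▸ hGp_top x y
    · exact PoissonChain.cyclePotential_eq_lcycleMean (P := P) x y fn ▸ hGn_top x y
  have hsol' : ∀ y, PoissonChain.poissonSol P π f y =
      fun x => (PoissonChain.cyclePotential P y fp x).toReal
        - (PoissonChain.cyclePotential P y fn x).toReal := fun y => funext fun x => (hsol x y).2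
  have hmean := fun y => PoissonChain.memL1_toReal_sub (hGp y) (hGn y)
  have hfpn : PoissonChain.pair π fp = PoissonChain.pair π fn := by
    have h1 := (PoissonChain.memL1_toReal_sub hfp_top hfn_top).2
    have h2 : (fun x => (fp x).toReal - (fn x).toReal) = fc :=
      funext fun x => PoissonChain.ofReal_toReal_sub _
    rw [h2, PoissonChain.mean_centered hf] at h1
    exact (ENNReal.toReal_eq_toReal_iff' hfp_top hfn_top).1 (by linarith)
  -- The cycle formula turns `πf_c = 0` into `g_y(y) = 0`.
  have hyy : ∀ y, PoissonChain.cyclePotential P y fp y = PoissonChain.cyclePotential P y fn y := by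
    intro y
    rw [PoissonChain.cycle_formula hirr hrec hπ y, PoissonChain.cycle_formula hirr hrec hπ y] at hfpn
    exact (ENNReal.mul_right_inj (hpos y) (π.apply_ne_top y)).1 hfpn
  have hmart : ∀ y (μ : PMF S), (∀ n, PoissonChain.pair μ
      ((PoissonChain.op (PoissonChain.matrix P))^[n] (PoissonChain.cyclePotential P y fa)) ≠ ∞) →
      Martingale (PoissonChain.poissonMartingale P π f y) PoissonChain.history
        (PoissonChain.pathLaw P μ) := fun y μ hμ =>
    PoissonChain.martingale_poissonMartingale (fun x => (hsol x y).2) hμ (hyy y) (hGp_top y y)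
  -- Since `πKⁿu = πu` is finite and `π` charges `x`, integrability passes from `P_π` to `P_x`.
  have hiter : ∀ {u : S → ℝ≥0∞}, PoissonChain.pair π u ≠ ∞ → ∀ n x, PoissonChain.pair (PMF.pure x)
      ((PoissonChain.op (PoissonChain.matrix P))^[n] u) ≠ ∞ := by
    intro u hu n x
    rw [PoissonChain.pair_pure]
    refine PoissonChain.ne_top_of_pair_ne_top hpos (h := (PoissonChain.op _)^[n] u) ?_ x
    rwa [PoissonChain.pair_iterate_op hπ.pair_op]
  refine ⟨fun x y => (hsol x y).1, fun y => hsol' y ▸ (hmean y).1, fun y => hmart y π fun n => ?_,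
    fun hap => ⟨?_, fun x => ?_⟩⟩
  · rw [PoissonChain.pair_iterate_op hπ.pair_op]
    exact hGa y
  · have hp : PoissonChain.lcycleMean P z z (fun j w => ENNReal.ofReal (((j : ℝ) + 1) * fc w))
        = PoissonChain.cyclePotential P z (PoissonChain.cyclePotential P z fp) z := by
      simp only [PoissonChain.ofReal_succ_mul]
      exact PoissonChain.lcycleMean_succ_mul z z fp
    have hn : PoissonChain.lcycleMean P z z (fun j w => ENNReal.ofReal (-(((j : ℝ) + 1) * fc w)))
        = PoissonChain.cyclePotential P z (PoissonChain.cyclePotential P z fn) z := by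
      simp only [← mul_neg, PoissonChain.ofReal_succ_mul]
      exact PoissonChain.lcycleMean_succ_mul z z fn
    have ep := PoissonChain.cycle_formula hirr hrec hπ z (PoissonChain.cyclePotential P z fp)
    have en := PoissonChain.cycle_formula hirr hrec hπ z (PoissonChain.cyclePotential P z fn)
    -- Kac's formula: the cycle formula for the constant `1`.
    have e1 : 1 = π z * PoissonChain.meanReturnTime P z z := by
      rw [PoissonChain.meanReturnTime_eq]
      refine Eq.trans ?_ (PoissonChain.cycle_formula hirr hrec hπ z 1)
      simp [PoissonChain.pair, π.tsum_coe]
    have hp_top : PoissonChain.cyclePotential P z (PoissonChain.cyclePotential P z fp) z ≠ ∞ :=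
      fun e => hGp z (by rw [ep, e, ENNReal.mul_top (hpos z)])
    have hn_top : PoissonChain.cyclePotential P z (PoissonChain.cyclePotential P z fn) z ≠ ∞ :=
      fun e => hGn z (by rw [en, e, ENNReal.mul_top (hpos z)])
    obtain ⟨hi, he⟩ := PoissonChain.integrable_cycleSum (hτ z z) (fun j w => ((j : ℝ) + 1) * fc w)
      (hp ▸ hp_top) (hn ▸ hn_top)
    refine ⟨hi, ?_⟩
    rw [he, hp, hn, hsol' z, (hmean z).2, ep, en, ENNReal.toReal_mul, ENNReal.toReal_mul, ← mul_sub]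
    have e2 := congrArg ENNReal.toReal e1
    rw [ENNReal.toReal_mul, ENNReal.toReal_one] at e2
    have e3 : (PoissonChain.meanReturnTime P z z).toReal ≠ 0 := fun e0 => by simp [e0] at e2
    rw [eq_div_iff e3, mul_right_comm, ← e2, one_mul]
  · have hint : ∀ n, Integrable (fun ω : ℕ → S => PoissonChain.poissonSol P π f z (ω n))
        (PoissonChain.lawFrom P x) := fun n => by
      rw [hsol' z]
      exact (PoissonChain.integrable_eval_sub (hiter (hGp z) n x) (hiter (hGn z) n x)).1
    have hconv : ∀ {u : S → ℝ≥0∞}, PoissonChain.pair π u ≠ ∞ → Tendsto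
        (fun n => (∫⁻ ω, u (ω n) ∂PoissonChain.lawFrom P x).toReal) atTop
        (𝓝 (PoissonChain.pair π u).toReal) := by
      intro u hu
      have h1 := PoissonChain.tendsto_iterate_op PoissonChain.tsum_matrix π.tsum_coe hπ.pair_op
        hirr.exists_iterate_ne_zero hap.eq_one_of_dvd hu x
      simp only [PoissonChain.lawFrom, PoissonChain.lintegral_eval, PoissonChain.pair_pure]
      exact (ENNReal.tendsto_toReal hu).comp h1
    have hlim : Tendsto (fun n : ℕ => ∫ ω, PoissonChain.poissonSol P π f z (ω n)
        ∂(PoissonChain.lawFrom P x)) atTop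
        (𝓝 (PoissonChain.mean π (PoissonChain.poissonSol P π f z))) := by
      rw [hsol' z, (hmean z).2]
      refine ((hconv (hGp z)).sub (hconv (hGn z))).congr fun n => ?_
      have := (PoissonChain.integrable_eval_sub (hiter (hGp z) n x) (hiter (hGn z) n x)).2 Set.univ
      simp only [Measure.restrict_univ] at this
      exact this.symm
    have hfc_int : ∀ n, Integrable (fun ω : ℕ → S => fc (ω n)) (PoissonChain.lawFrom P x) := by
      intro n
      have h2 : fc = fun x => (fp x).toReal - (fn x).toReal :=
        funext fun x => (PoissonChain.ofReal_toReal_sub _).symm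
      rw [h2]
      exact (PoissonChain.integrable_eval_sub (hiter hfp_top n x) (hiter hfn_top n x)).1
    have hsum_int : ∀ n, Integrable (PoissonChain.partialSum fc n) (PoissonChain.lawFrom P x) :=
      fun n => integrable_finsetSum _ fun i _ => hfc_int i
    have hS : ∀ n, PoissonChain.partialSum f n = fun ω : ℕ → S =>
        n * PoissonChain.mean π f + PoissonChain.partialSum fc n ω := by
      intro n
      funext ω
      simp [PoissonChain.partialSum, hfc, PoissonChain.centered]
    have hSf : ∀ n, Integrable (PoissonChain.partialSum f n) (PoissonChain.lawFrom P x) :=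
      fun n => hS n ▸ (integrable_const _).add (hsum_int n)
    refine ⟨⟨hint, hlim⟩, hSf, ?_⟩
    -- Under `P_x` the martingale has constant expectation `g_z(x)`, its value at time `0`.
    have hM := hmart z (PMF.pure x) fun n => hiter (hGa z) n x
    have hbal : ∀ n, ∫ ω, PoissonChain.poissonSol P π f z (ω n) ∂(PoissonChain.lawFrom P x)
        + ∫ ω, PoissonChain.partialSum fc n ω ∂(PoissonChain.lawFrom P x)
        = PoissonChain.poissonSol P π f z x := by
      intro n
      have h1 := hM.setIntegral_eq (Nat.zero_le n) MeasurableSet.univ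
      rw [setIntegral_univ, setIntegral_univ] at h1
      rw [← integral_add (hint n) (hsum_int n)]
      refine h1.symm.trans ?_
      have h0 : ∀ ω : ℕ → S, PoissonChain.poissonMartingale P π f z 0 ω
          = PoissonChain.poissonSol P π f z (ω 0) := fun ω => by
        simp [PoissonChain.poissonMartingale, PoissonChain.partialSum]
      simp only [h0]
      have h3 := (PoissonChain.integrable_eval_sub (hiter (hGp z) 0 x) (hiter (hGn z) 0 x)).2
        Set.univ
      simp only [Measure.restrict_univ, PoissonChain.lintegral_eval_zero, PoissonChain.pair_pure] at h3
      rw [hsol' z]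
      exact h3
    have hfinal : ∀ n : ℕ, (∫ ω, PoissonChain.partialSum f n ω ∂(PoissonChain.lawFrom P x))
        - ((n : ℝ) * PoissonChain.mean π f + PoissonChain.poissonSol P π f z x
          - PoissonChain.mean π (PoissonChain.poissonSol P π f z))
        = PoissonChain.mean π (PoissonChain.poissonSol P π f z)
          - ∫ ω, PoissonChain.poissonSol P π f z (ω n) ∂(PoissonChain.lawFrom P x) := by
      intro n
      rw [hS n, integral_add (integrable_const _) (hsum_int n), integral_const, probReal_univ,
        one_smul, ← hbal n]
      ring
    simp only [hfinal]
    simpa using (tendsto_const_nhds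
      (x := PoissonChain.mean π (PoissonChain.poissonSol P π f z))).sub hlim
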